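/- Let $n\ge 1$ and $m>\mu\ge 0$ be integers, write $\xi=(\xi',\xi_n)\in\mathbb R^{n-1}\times\mathbb R$, and let $$A(\xi,\lambda)=A_{2m}(\xi)+\lambda A_{2m-1}(\xi)+\dots+\lambda^{2m-2\mu}A_{2\mu}(\xi),$$ where each $A_j$ is a homogeneous polynomial of degree $j$ in $\xi$ with complex coefficients. Assume: (a) ($N$-ellipticity with parameter in $[0,\infty)$) there is a constant $c>0$ with $|A(\xi,\lambda)|\ge c\,|\xi|^{2\mu}(\lambda+|\xi|)^{2m-2\mu}$ for all $\xi\in\mathbb R^n$ and $\lambda\in[0,\infty)$ (with $0^0=1$); (b) (regular degeneration for $\lambda\to\infty$) the polynomial $Q(\tau)=\tau^{-2\mu}A(0,\tau,1)$ has exactly $m-\mu$ roots with positive imaginary part, counted with multiplicity; (c) if $n\le 2$: for all $\xi'\in\mathbb R^{n-1}\setminus\{0\}$ and $\lambda\in[0,\infty)$ the polynomial $\tau\mapsto A(\xi',\tau,\lambda)$ has exactly $m$ roots with positive imaginary part, counted with multiplicity. (For $n>2$ this is not assumed.) Let $D_t=-i\,\frac{d}{dt}$. For $\xi'\in\mathbb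 R^{n-1}\setminus\{0\}$, $\lambda\in[0,\infty)$ and $j\in\{1,\dots,m\}$ consider the problem $$A(\xi',D_t,\lambda)w_j(t)=0\ (t>0),\qquad D_t^{k-1}w_j(0)=\delta_{jk}\ (k=1,\dots,m),\qquad w_j(t)\to 0\ (t\to+\infty).$$ Then for all such $\xi',\lambda,j$ this problem has exactly one solution $w_j=w_j(\xi',\cdot,\lambda)$ in $C^{2m}((0,\infty))\cap C^{m-1}([0,\infty))$, and this solution belongs to $C^\infty([0,\infty))$. Moreover, for every $j\in\{1,\dots,m\}$ and every integer $l\ge 0$ there is a constant $C$, not depending on $\xi'$ and $\lambda$, such that for all $\xi'\in\mathbb R^{n-1}\setminus\{0\}$ and $\lambda\in[0,\infty)$ $$\|D_t^l w_j(\xi',\cdot,\lambda)\|_{L_2(\mathbb R_+)}\le C\cdot\begin{cases} |\xi'|^{l-j+\frac12}, & j\le\mu,\ l\le\mu,\\ |\xi'|^{1+\mu-j}(\lambda+|\xi'|)^{l-\mu-\frac12}, & j\le\mu,\ l>\mu,\\ |\xi'|^{l-\mu}(\lambda+|\xi'|)^{\mu-j+\frac12}, & j>\mu,\ l\le\mu,\\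 (\lambda+|\xi'|)^{l-j+\frac12}, & j>\mu,\ l>\mu. \end{cases}$$ -/

import Mathlib

open Set Filter Topology MeasureTheory
open scoped ENNReal ContDiff Polynomial

noncomputable section

namespace OdePencil

/-- The pencil `A(x, lam) = A_{2m}(x) + lam * A_{2m-1}(x) + ⋯ + lam ^ (2m-2μ) * A_{2μ}(x)`, where
`A j` is the polynomial `A_j` in `n` variables with complex coefficients. The argument `x` may have
coordinates in any commutative `ℂ`-algebra: numbers, or polynomials in an indeterminate `τ`. -/
def pencil {n : ℕ} (A : ℕ → MvPolynomial (Fin n) ℂ) (m μ : ℕ) {R : Type} [CommRing R]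
    [Algebra ℂ R] (x : Fin n → R) (lam : ℝ) : R :=
  ∑ j ∈ Finset.Icc (2 * μ) (2 * m),
    algebraMap ℂ R ((lam : ℂ) ^ (2 * m - j)) * MvPolynomial.aeval x (A j)

/-- `N`-ellipticity with parameter in `[0, ∞)`:
`|A(ξ, lam)| ≥ C |ξ| ^ (2μ) (lam + |ξ|) ^ (2m-2μ)` for all `ξ ∈ ℝⁿ` and `lam ≥ 0`. -/
def IsNElliptic {n : ℕ} (A : ℕ → MvPolynomial (Fin n) ℂ) (m μ : ℕ) : Prop :=
  ∃ C : ℝ, 0 < C ∧ ∀ (ξ : EuclideanSpace ℝ (Fin n)) (lam : ℝ), 0 ≤ lam →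
    C * ‖ξ‖ ^ (2 * μ) * (lam + ‖ξ‖) ^ (2 * m - 2 * μ)
      ≤ ‖pencil A m μ (fun i => (ξ i : ℂ)) lam‖

/-- `A(ξ', τ, lam)` as a polynomial in `τ`; here `ξ = (ξ', τ)`, the last variable being `τ`. -/
def symbolPoly {d : ℕ} (A : ℕ → MvPolynomial (Fin (d + 1)) ℂ) (m μ : ℕ)
    (ξ' : EuclideanSpace ℝ (Fin d)) (lam : ℝ) : ℂ[X] :=
  pencil A m μ
    (Fin.snoc (α := fun _ => ℂ[X]) (fun i => Polynomial.C (ξ' i : ℂ)) Polynomial.X) lam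

/-- The auxiliary polynomial `Q(τ) = τ ^ (-2μ) A(0, τ, 1)`. -/
def auxPoly {d : ℕ} (A : ℕ → MvPolynomial (Fin (d + 1)) ℂ) (m μ : ℕ) : ℂ[X] :=
  symbolPoly A m μ 0 1 /ₘ Polynomial.X ^ (2 * μ)

open Classical in
/-- The number of roots with positive imaginary part, counted with multiplicity. -/
def numUpperRoots (p : ℂ[X]) : ℕ :=
  p.roots.countP (fun z => 0 < z.im)

/-- `A` degenerates regularly for `lam → ∞`: `Q` has exactly `m - μ` roots with positive imaginary
part, counted with multiplicity. -/
def DegeneratesRegularly {d : ℕ} (A : ℕ → MvPolynomial (Fin (d + 1)) ℂ) (m μ : ℕ) : Prop :=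
  numUpperRoots (auxPoly A m μ) = m - μ

/-- `D_t ^ l w` on the closed half-line `[0, ∞)`, with `D_t = -i d/dt` (one-sided at `0`). -/
def Dt (l : ℕ) (w : ℝ → ℂ) (t : ℝ) : ℂ :=
  (-Complex.I) ^ l * iteratedDerivWithin l w (Ici 0) t

/-- `w` is a classical solution of the `j`-th half-line problem: it has `2m` continuous derivatives
for `t > 0` and `m - 1` continuous derivatives up to `t = 0`, it satisfies
`A(ξ', D_t, lam) w = 0` for `t > 0` and `D_t ^ (k-1) w (0) = δ_{jk}` for `k = 1, …, m`, and it
tends to `0` at infinity. Only the values of `w` on `[0, ∞)` matter. -/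
structure IsHalfLineSolution {d : ℕ} (A : ℕ → MvPolynomial (Fin (d + 1)) ℂ) (m μ : ℕ)
    (ξ' : EuclideanSpace ℝ (Fin d)) (lam : ℝ) (j : ℕ) (w : ℝ → ℂ) : Prop where
  contDiffOn_Ioi : ContDiffOn ℝ (2 * m : ℕ) w (Ioi 0)
  contDiffOn_Ici : ContDiffOn ℝ (m - 1 : ℕ) w (Ici 0)
  equation : ∀ t : ℝ, 0 < t → ((symbolPoly A m μ ξ' lam).sum fun k a => a * Dt k w t) = 0
  initial : ∀ k ∈ Finset.Icc 1 m, Dt (k - 1) w 0 = if j = k then 1 else 0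
  decay : Tendsto w atTop (𝓝 0)

/-- The right-hand side of the estimate without the constant, where `a = |ξ'|` and
`b = lam + |ξ'|`. -/
def estimateBound (μ j l : ℕ) (a b : ℝ) : ℝ :=
  if j ≤ μ then
    if l ≤ μ then a ^ ((l : ℝ) - j + 1 / 2)
    else a ^ (1 + (μ : ℝ) - j) * b ^ ((l : ℝ) - μ - 1 / 2)
  else
    if l ≤ μ then a ^ ((l : ℝ) - μ) * b ^ ((μ : ℝ) - j + 1 / 2)
    else b ^ ((l : ℝ) - j + 1 / 2)

end OdePencil

end

noncomputable section

namespace OdePencil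

/-! Put a = |ξ'| and b = λ + |ξ'|. The estimate rests on the position of the roots of τ ↦ A(ξ', τ,
λ) in the upper half-plane: there are m of them, and they can be ordered so that μ have modulus and
imaginary part of order a and the other m - μ of order b, uniformly in ξ' and λ
(`exists_splitsWithOrders`).

By homogeneity the pencil varies little, compared with the elliptic weight, under relatively small
changes of the covector (`exists_pencil_sub_le`). Perturbing from real covectors keeps the roots off
the real axis (`exists_im_root_ge`); perturbing from ξ' = 0 shows that roots much larger than a are
comparable to λ (`exists_root_comparable`). Root counts are then constant along deformations. For d
≥ 2 one deforms to λ = 0 and reflects ξ' to -ξ', which gives m upper roots. If a is small against λ,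
one deforms to ξ' = 0, λ = 1, where the large upper roots are those of Q, hence m - μ in number.
Otherwise a and b are comparable and nothing has to be separated.

Let w_i = (D - τ_0)⋯(D - τ_{i-1})w with the upper roots τ_i, and require w_m = 0. This is a chain of
first-order equations (D - τ_i)w_i = w_{i+1}, solved backwards (`exists_chain`). The conditions
D^{k-1}w(0) = δ_{jk} amount to w_i(0) being the coefficient of X^{j-1} in ∏_{s<i}(X - τ_s), which is
bounded by powers of a and b. The energy estimate for each equation gains a factor 1 / Im τ_i
(`eLpNorm_le_of_diffOp_sub_smul_eq`), and D^{l+1}w_i = D^l w_{i+1} + τ_i D^l w_i propagates the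
bounds to derivatives. Distances between roots never enter, so multiple roots do no harm to
uniformity.

For uniqueness only w itself is known to decay, not its derivatives. Therefore D - z is replaced by
T - exp(iz) with T the translation by 1, which preserves decay; |exp(iz)| is greater or less than 1
according to the half-plane of z. This removes the lower roots (`diffProd_eq_zero_of_vanishing`),
and an equation of order m with m vanishing initial values remains. -/

/-! ### Continuity of the roots of a polynomial and stability of root counts -/

open Polynomial in
/-- The roots of a complex polynomial can be listed as a tuple. -/
theorem exists_roots_tuple (p : ℂ[X]) {N : ℕ} (hp : p.natDegree = N) :
    ∃ z : Fin N → ℂ, p.roots = Finset.univ.val.map z := by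
  have hcard : p.roots.toList.length = N := by
    rw [Multiset.length_toList, ← hp]
    exact (splits_iff_card_roots.1 (IsAlgClosed.splits p))
  subst hcard
  refine ⟨fun i => p.roots.toList.get i, ?_⟩
  conv_lhs => rw [← Multiset.coe_toList p.roots]
  have h := List.ofFn_get p.roots.toList
  conv_lhs => rw [← h]
  rw [Fin.univ_val_map]

open Polynomial in
theorem eval_eq_prod_of_roots_eq {N : ℕ} {p : ℂ[X]} {z : Fin N → ℂ} (hp : p.natDegree = N)
    (hz : p.roots = Finset.univ.val.map z) (t : ℂ) :
    p.eval t = p.coeff N * ∏ i, (t - z i) := by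
  have h := (IsAlgClosed.splits p).eq_prod_roots
  conv_lhs => rw [h]
  rw [hz, eval_mul, eval_C, leadingCoeff, hp, Multiset.map_map, Finset.prod_map_val, eval_prod]
  simp

open Classical in
theorem countP_roots_tuple {X : Type*} {N : ℕ} {S : Set (X × ℂ)} {q : ℂ[X]} {z : Fin N → ℂ}
    (hz : q.roots = Finset.univ.val.map z) (x : X) :
    q.roots.countP (fun w => (x, w) ∈ S) = (Finset.univ.filter fun i => (x, z i) ∈ S).card := by
  rw [hz, Multiset.countP_map]
  rfl

section RootCount

variable {X : Type*} [TopologicalSpace X] {N : ℕ} {p : X → ℂ[X]} {S T : Set (X × ℂ)}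

-- Roots of nearby polynomials stay in a fixed ball by the Cauchy bound, so a subsequence of root
-- tuples converges, necessarily to the roots of the limit polynomial. Each limit root lies in one
-- of two disjoint open sets, so membership in `S` is eventually decided in the same way.
open Classical Polynomial in
theorem tendsto_countP_roots [FirstCountableTopology X]
    (hdeg : ∀ x, (p x).natDegree = N) (hlead : ∀ x, (p x).coeff N ≠ 0)
    (hcont : ∀ k, Continuous fun x => (p x).coeff k)
    (hS : IsOpen S) (hT : IsOpen T) (hST : Disjoint S T)
    (hroot : ∀ x z, (p x).IsRoot z → (x, z) ∈ S ∨ (x, z) ∈ T) (x : X) :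
    Tendsto (fun y => (p y).roots.countP fun w => (y, w) ∈ S) (𝓝 x)
      (𝓝 ((p x).roots.countP fun w => (x, w) ∈ S)) := by
  refine tendsto_of_subseq_tendsto fun ns hns => ?_
  choose Z hZ using fun n => exists_roots_tuple (p (ns n)) (hdeg (ns n))
  have hne : ∀ y, p y ≠ 0 := fun y h => hlead y (by simp [h])
  have hbc : Continuous fun y => cauchyBound (p y) := by
    simp only [cauchyBound, leadingCoeff, hdeg]
    refine Continuous.add (Continuous.div ?_ (hcont N).nnnorm fun y => by simpa using hlead y)
      continuous_const
    exact Continuous.finset_sup_apply fun k _ => (hcont k).nnnorm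
  have hev : ∀ᶠ n in atTop, cauchyBound (p (ns n)) < cauchyBound (p x) + 1 :=
    ((hbc.tendsto x).comp hns).eventually_lt_const (lt_add_one _)
  have hmem : ∀ᶠ n in atTop, Z n ∈ Metric.closedBall (0 : Fin N → ℂ) (cauchyBound (p x) + 1) := by
    filter_upwards [hev] with n hn
    rw [mem_closedBall_zero_iff, pi_norm_le_iff_of_nonneg (by positivity)]
    intro i
    have hr : (p (ns n)).IsRoot (Z n i) := by
      refine isRoot_of_mem_roots ?_
      rw [hZ n]
      exact Multiset.mem_map_of_mem _ (Finset.mem_univ_val i)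
    exact_mod_cast ((hr.norm_lt_cauchyBound (hne _)).trans hn).le
  obtain ⟨z, -, φ, hφ, hz⟩ :=
    (isCompact_closedBall (0 : Fin N → ℂ) (cauchyBound (p x) + 1 : ℝ)).tendsto_subseq'
      hmem.frequently
  refine ⟨φ, ?_⟩
  have hsub : Tendsto (fun n => ns (φ n)) atTop (𝓝 x) := hns.comp hφ.tendsto_atTop
  have hzi : ∀ i, Tendsto (fun n => Z (φ n) i) atTop (𝓝 (z i)) := fun i =>
    tendsto_pi_nhds.1 hz i
  -- The factorisation passes to the limit pointwise in `t`; this identifies the limits `z i` as the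
  -- roots of `p x` with multiplicity.
  have hpx : p x = C ((p x).coeff N) * (Finset.univ.val.map fun i => Polynomial.X - C (z i)).prod := by
    refine Polynomial.funext fun t => ?_
    have h1 : Tendsto (fun n => (p (ns (φ n))).eval t) atTop (𝓝 ((p x).eval t)) := by
      simp only [eval_eq_sum_range, hdeg]
      exact tendsto_finsetSum _ fun k _ =>
        (((hcont k).tendsto x).comp hsub).mul tendsto_const_nhds
    have h2 : Tendsto (fun n => (p (ns (φ n))).eval t) atTop
        (𝓝 ((p x).coeff N * ∏ i, (t - z i))) := by
      simp only [fun n => eval_eq_prod_of_roots_eq (hdeg _) (hZ (φ n)) t]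
      exact (((hcont N).tendsto x).comp hsub).mul
        (tendsto_finsetProd _ fun i _ => tendsto_const_nhds.sub (hzi i))
    rw [tendsto_nhds_unique h1 h2, eval_mul, eval_C, Finset.prod_map_val, eval_prod]
    simp
  have hzx : (p x).roots = Finset.univ.val.map z := by
    rw [hpx, roots_C_mul _ (hlead x)]
    have := roots_multiset_prod_X_sub_C (Finset.univ.val.map z)
    rwa [Multiset.map_map] at this
  rw [countP_roots_tuple hzx]
  simp only [fun n => countP_roots_tuple (S := S) (hZ (φ n)) (ns (φ n))]
  refine tendsto_const_nhds.congr' ?_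
  have key : ∀ i, ∀ᶠ n in atTop, ((x, z i) ∈ S ↔ (ns (φ n), Z (φ n) i) ∈ S) := by
    intro i
    have hr : (p x).IsRoot (z i) := by
      refine isRoot_of_mem_roots ?_
      rw [hzx]
      exact Multiset.mem_map_of_mem _ (Finset.mem_univ_val i)
    have hl : Tendsto (fun n => (ns (φ n), Z (φ n) i)) atTop (𝓝 (x, z i)) :=
      hsub.prodMk_nhds (hzi i)
    rcases hroot x _ hr with h | h
    · filter_upwards [hl.eventually (hS.mem_nhds h)] with n hn
      exact iff_of_true h hn
    · filter_upwards [hl.eventually (hT.mem_nhds h)] with n hn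
      exact iff_of_false (fun h' => disjoint_left.1 hST h' h) fun h' => disjoint_left.1 hST h' hn
  filter_upwards [eventually_all.2 key] with n hn
  congr 1
  ext i
  simp [hn i]

open Classical in
/-- The number of roots in a region which moves with the parameter does not change as long as no
root meets the boundary of the region. -/
theorem countP_roots_eq [FirstCountableTopology X] [PreconnectedSpace X]
    (hdeg : ∀ x, (p x).natDegree = N) (hlead : ∀ x, (p x).coeff N ≠ 0)
    (hcont : ∀ k, Continuous fun x => (p x).coeff k)
    (hS : IsOpen S) (hT : IsOpen T) (hST : Disjoint S T)
    (hroot : ∀ x z, (p x).IsRoot z → (x, z) ∈ S ∨ (x, z) ∈ T) (x y : X) :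
    (p x).roots.countP (fun w => (x, w) ∈ S) = (p y).roots.countP fun w => (y, w) ∈ S := by
  have hc : Continuous fun y => (p y).roots.countP fun w => (y, w) ∈ S :=
    continuous_iff_continuousAt.2 (tendsto_countP_roots hdeg hlead hcont hS hT hST hroot)
  exact PreconnectedSpace.constant ‹_› hc

end RootCount

/-! ### The pencil as a polynomial in τ, and its perturbation -/

theorem aeval_mul_of_isHomogeneous {σ : Type*} {f : MvPolynomial σ ℂ} {k : ℕ}
    (hf : f.IsHomogeneous k) (r : ℂ) (x : σ → ℂ) :
    MvPolynomial.aeval (fun i => r * x i) f = r ^ k * MvPolynomial.aeval x f := by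
  rw [MvPolynomial.aeval_def, MvPolynomial.aeval_def, MvPolynomial.eval₂_eq, MvPolynomial.eval₂_eq,
    Finset.mul_sum]
  refine Finset.sum_congr rfl fun s hs => ?_
  have hdeg : ∑ i ∈ s.support, s i = k := by
    have := hf (MvPolynomial.mem_support_iff.1 hs)
    rwa [Finsupp.weight_apply, Finsupp.sum, Finset.sum_congr rfl fun i _ => by
      rw [Pi.one_apply, smul_eq_mul, mul_one]] at this
  simp only [mul_pow, Finset.prod_mul_distrib, Finset.prod_pow_eq_pow_sum, hdeg]
  ring

theorem continuous_aeval_mvPolynomial {σ : Type*} (f : MvPolynomial σ ℂ) :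
    Continuous fun x : σ → ℂ => MvPolynomial.aeval x f := by
  simp only [MvPolynomial.aeval_def, MvPolynomial.eval₂_eq]
  fun_prop

open Polynomial in
/-- The coefficients of `f(x, τ)` as a polynomial in `τ`. -/
theorem coeff_aeval_snoc {d : ℕ} (f : MvPolynomial (Fin (d + 1)) ℂ) (x : Fin d → ℂ) (k : ℕ) :
    (MvPolynomial.aeval (Fin.snoc (α := fun _ => ℂ[X]) (fun i => C (x i)) X) f).coeff k =
      ∑ s ∈ f.support, if s (Fin.last d) = k
        then f.coeff s * ∏ i : Fin d, x i ^ s i.castSucc else 0 := by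
  rw [MvPolynomial.aeval_def, MvPolynomial.eval₂_eq', finsetSum_coeff]
  refine Finset.sum_congr rfl fun s _ => ?_
  simp only [Fin.prod_univ_castSucc, Fin.snoc_castSucc, Fin.snoc_last, ← C_pow, algebraMap_eq,
    ← map_prod, ← mul_assoc, ← C_mul]
  rw [coeff_C_mul_X_pow]
  simp only [eq_comm]

section Symbol

variable {d m μ : ℕ} {A : ℕ → MvPolynomial (Fin (d + 1)) ℂ}

theorem pencil_complex (ζ : Fin (d + 1) → ℂ) (lam : ℝ) :
    pencil A m μ ζ lam = ∑ j ∈ Finset.Icc (2 * μ) (2 * m),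
      (lam : ℂ) ^ (2 * m - j) * MvPolynomial.aeval ζ (A j) := rfl

theorem map_pencil {R R' : Type} [CommRing R] [Algebra ℂ R] [CommRing R'] [Algebra ℂ R']
    (φ : R →ₐ[ℂ] R') (x : Fin (d + 1) → R) (lam : ℝ) :
    φ (pencil A m μ x lam) = pencil A m μ (fun i => φ (x i)) lam := by
  simp only [pencil, map_sum, map_mul, AlgHom.commutes]
  refine Finset.sum_congr rfl fun j _ => ?_
  congr 1
  exact (MvPolynomial.comp_aeval_apply x φ (A j))

/-- The complex covector `(ξ', τ)`. -/
def covector (ξ' : EuclideanSpace ℝ (Fin d)) (τ : ℂ) : Fin (d + 1) → ℂ :=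
  Fin.snoc (α := fun _ => ℂ) (fun i => (ξ' i : ℂ)) τ

/-- The real covector `(ξ', σ)`. -/
def realCovector (ξ' : EuclideanSpace ℝ (Fin d)) (σ : ℝ) : EuclideanSpace ℝ (Fin (d + 1)) :=
  WithLp.toLp 2 (Fin.snoc (α := fun _ => ℝ) (fun i => ξ' i) σ)

theorem realCovector_coe (ξ' : EuclideanSpace ℝ (Fin d)) (σ : ℝ) :
    (fun i => (realCovector ξ' σ i : ℂ)) = covector ξ' σ := by
  funext i
  refine Fin.lastCases ?_ (fun i => ?_) i <;> simp [realCovector, covector]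

theorem eval_symbolPoly (ξ' : EuclideanSpace ℝ (Fin d)) (lam : ℝ) (τ : ℂ) :
    (symbolPoly A m μ ξ' lam).eval τ = pencil A m μ (covector ξ' τ) lam := by
  have h := map_pencil (A := A) (m := m) (μ := μ) (Polynomial.aeval (R := ℂ) τ)
    (Fin.snoc (α := fun _ => ℂ[X]) (fun i => Polynomial.C (ξ' i : ℂ)) Polynomial.X) lam
  rw [symbolPoly, ← Polynomial.coe_aeval_eq_eval, h]
  congr 1
  funext i
  refine Fin.lastCases ?_ (fun i => ?_) i <;> simp [covector]

theorem coeff_symbolPoly (ξ' : EuclideanSpace ℝ (Fin d)) (lam : ℝ) (k : ℕ) :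
    (symbolPoly A m μ ξ' lam).coeff k = ∑ j ∈ Finset.Icc (2 * μ) (2 * m),
      (lam : ℂ) ^ (2 * m - j) * ∑ s ∈ (A j).support, if s (Fin.last d) = k
        then (A j).coeff s * ∏ i : Fin d, (ξ' i : ℂ) ^ s i.castSucc else 0 := by
  simp only [symbolPoly, pencil, Polynomial.finsetSum_coeff, Polynomial.algebraMap_eq,
    Polynomial.coeff_C_mul, coeff_aeval_snoc]

theorem continuous_coeff_symbolPoly (k : ℕ) :
    Continuous fun x : EuclideanSpace ℝ (Fin d) × ℝ => (symbolPoly A m μ x.1 x.2).coeff k := by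
  simp only [coeff_symbolPoly]
  refine continuous_finsetSum _ fun j _ => Continuous.mul (by fun_prop) ?_
  refine continuous_finsetSum _ fun s _ => ?_
  split_ifs
  · fun_prop
  · exact continuous_const

theorem natDegree_symbolPoly_le (hhom : ∀ j ∈ Finset.Icc (2 * μ) (2 * m), (A j).IsHomogeneous j)
    (ξ' : EuclideanSpace ℝ (Fin d)) (lam : ℝ) :
    (symbolPoly A m μ ξ' lam).natDegree ≤ 2 * m := by
  refine Polynomial.natDegree_sum_le_of_forall_le (Finset.Icc (2 * μ) (2 * m)) (fun j =>
    algebraMap ℂ ℂ[X] ((lam : ℂ) ^ (2 * m - j)) * MvPolynomial.aeval (Fin.snoc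
      (α := fun _ => ℂ[X]) (fun i => Polynomial.C (ξ' i : ℂ)) Polynomial.X) (A j)) fun j hj => ?_
  rw [Polynomial.algebraMap_eq]
  refine (Polynomial.natDegree_C_mul_le _ _).trans ?_
  refine (MvPolynomial.aeval_natDegree_le (n := 1) _ (hhom j hj).totalDegree_le _
    fun i => ?_).trans (by rw [mul_one]; exact (Finset.mem_Icc.1 hj).2)
  refine Fin.lastCases ?_ (fun i => ?_) i <;> simp

/-- Only `A (2 * m)` reaches degree 2m in τ, and its monomials of that τ-degree have no factor in
ξ'. A constant leading coefficient means that the number of roots is fixed and none escapes to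
infinity as the parameters vary. -/
theorem coeff_symbolPoly_top (hhom : ∀ j ∈ Finset.Icc (2 * μ) (2 * m), (A j).IsHomogeneous j)
    (ξ' : EuclideanSpace ℝ (Fin d)) (lam : ℝ) :
    (symbolPoly A m μ ξ' lam).coeff (2 * m) = (symbolPoly A m μ 0 0).coeff (2 * m) := by
  rw [coeff_symbolPoly, coeff_symbolPoly]
  refine Finset.sum_congr rfl fun j hj => ?_
  have hdeg : ∀ s ∈ (A j).support, ∑ i : Fin d, s i.castSucc + s (Fin.last d) = j := by
    intro s hs
    have := hhom j hj (MvPolynomial.mem_support_iff.1 hs)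
    rw [Finsupp.weight_apply, Finsupp.sum_fintype _ _ (by simp), Fin.sum_univ_castSucc] at this
    simpa using this
  rcases (Finset.mem_Icc.1 hj).2.lt_or_eq with hlt | rfl
  · rw [Finset.sum_eq_zero, Finset.sum_eq_zero]
    · simp
    all_goals
      intro s hs
      rw [if_neg]
      have := hdeg s hs
      omega
  · congr 1
    · simp
    refine Finset.sum_congr rfl fun s hs => ?_
    split_ifs with h
    · have h0 : ∑ i : Fin d, s i.castSucc = 0 := by have := hdeg s hs; omega
      rw [Finset.sum_eq_zero_iff] at h0
      simp [h0]
    · rfl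

theorem pencil_mul (hhom : ∀ j ∈ Finset.Icc (2 * μ) (2 * m), (A j).IsHomogeneous j)
    (ζ : Fin (d + 1) → ℂ) (lam : ℝ) (r : ℂ) :
    pencil A m μ (fun i => r * ζ i) lam = ∑ j ∈ Finset.Icc (2 * μ) (2 * m),
      (lam : ℂ) ^ (2 * m - j) * (r ^ j * MvPolynomial.aeval ζ (A j)) := by
  rw [pencil_complex]
  exact Finset.sum_congr rfl fun j hj => by rw [aeval_mul_of_isHomogeneous (hhom j hj)]

theorem covector_zero (τ : ℂ) : covector (0 : EuclideanSpace ℝ (Fin d)) τ =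
    fun i => τ * covector (0 : EuclideanSpace ℝ (Fin d)) 1 i := by
  funext i
  refine Fin.lastCases ?_ (fun i => ?_) i <;> simp [covector]

/-- The coefficient of `τ ^ j` in `A_j(0, τ)`. -/
def conormalCoeff (A : ℕ → MvPolynomial (Fin (d + 1)) ℂ) (j : ℕ) : ℂ :=
  MvPolynomial.aeval (covector (0 : EuclideanSpace ℝ (Fin d)) 1) (A j)

theorem pencil_conormal (hhom : ∀ j ∈ Finset.Icc (2 * μ) (2 * m), (A j).IsHomogeneous j)
    (τ : ℂ) (lam : ℝ) :
    pencil A m μ (covector (0 : EuclideanSpace ℝ (Fin d)) τ) lam =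
      ∑ j ∈ Finset.Icc (2 * μ) (2 * m), (lam : ℂ) ^ (2 * m - j) * τ ^ j * conormalCoeff A j := by
  rw [covector_zero, pencil_mul hhom]
  simp only [conormalCoeff, mul_assoc]

theorem norm_realCovector_sq (ξ' : EuclideanSpace ℝ (Fin d)) (σ : ℝ) :
    ‖realCovector ξ' σ‖ ^ 2 = ‖ξ'‖ ^ 2 + σ ^ 2 := by
  rw [EuclideanSpace.norm_sq_eq, EuclideanSpace.norm_sq_eq, Fin.sum_univ_castSucc]
  simp [realCovector]

theorem norm_le_norm_realCovector (ξ' : EuclideanSpace ℝ (Fin d)) (σ : ℝ) :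
    ‖ξ'‖ ≤ ‖realCovector ξ' σ‖ :=
  (sq_le_sq₀ (norm_nonneg _) (norm_nonneg _)).1
    (by rw [norm_realCovector_sq]; nlinarith [sq_nonneg σ])

theorem abs_le_norm_realCovector (ξ' : EuclideanSpace ℝ (Fin d)) (σ : ℝ) :
    |σ| ≤ ‖realCovector ξ' σ‖ :=
  abs_le_of_sq_le_sq (by rw [norm_realCovector_sq]; nlinarith [sq_nonneg ‖ξ'‖]) (norm_nonneg _)

theorem pencil_realCovector_ge {c : ℝ} (hell : ∀ (ξ : EuclideanSpace ℝ (Fin (d + 1))) (lam : ℝ),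
      0 ≤ lam → c * ‖ξ‖ ^ (2 * μ) * (lam + ‖ξ‖) ^ (2 * m - 2 * μ)
        ≤ ‖pencil A m μ (fun i => (ξ i : ℂ)) lam‖)
    (ξ' : EuclideanSpace ℝ (Fin d)) (σ : ℝ) {lam : ℝ} (hlam : 0 ≤ lam) :
    c * ‖realCovector ξ' σ‖ ^ (2 * μ) * (lam + ‖realCovector ξ' σ‖) ^ (2 * m - 2 * μ)
        ≤ ‖pencil A m μ (covector ξ' σ) lam‖ := by
  rw [← realCovector_coe]
  exact hell _ _ hlam

theorem eval_symbolPoly_ofReal_ne_zero (hell : IsNElliptic A m μ) {ξ' : EuclideanSpace ℝ (Fin d)}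
    {σ lam : ℝ} (hξ : ξ' ≠ 0 ∨ σ ≠ 0) (hlam : 0 ≤ lam) :
    (symbolPoly A m μ ξ' lam).eval (σ : ℂ) ≠ 0 := by
  obtain ⟨c, hc, hell⟩ := hell
  have hpos : 0 < ‖realCovector ξ' σ‖ := by
    rcases hξ with h | h
    · exact (norm_pos_iff.2 h).trans_le (norm_le_norm_realCovector _ _)
    · exact (abs_pos.2 h).trans_le (abs_le_norm_realCovector _ _)
  rw [eval_symbolPoly, ← norm_pos_iff]
  refine lt_of_lt_of_le ?_ (pencil_realCovector_ge hell ξ' σ hlam)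
  positivity

theorem symbolPoly_conormal
    (hhom : ∀ j ∈ Finset.Icc (2 * μ) (2 * m), (A j).IsHomogeneous j) (lam : ℝ) :
    symbolPoly A m μ (0 : EuclideanSpace ℝ (Fin d)) lam = ∑ j ∈ Finset.Icc (2 * μ) (2 * m),
      Polynomial.C ((lam : ℂ) ^ (2 * m - j) * conormalCoeff A j) * Polynomial.X ^ j := by
  refine Polynomial.funext fun τ => ?_
  rw [eval_symbolPoly, pencil_conormal hhom, Polynomial.eval_finsetSum]
  refine Finset.sum_congr rfl fun j _ => ?_
  simp only [Polynomial.eval_mul, Polynomial.eval_C, Polynomial.eval_pow, Polynomial.eval_X]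
  ring

theorem coeff_symbolPoly_top_ne_zero (hμm : μ < m)
    (hhom : ∀ j ∈ Finset.Icc (2 * μ) (2 * m), (A j).IsHomogeneous j)
    (hell : IsNElliptic A m μ) (ξ' : EuclideanSpace ℝ (Fin d)) (lam : ℝ) :
    (symbolPoly A m μ ξ' lam).coeff (2 * m) ≠ 0 := by
  have h1 : symbolPoly A m μ (0 : EuclideanSpace ℝ (Fin d)) 0 =
      Polynomial.C (conormalCoeff A (2 * m)) * Polynomial.X ^ (2 * m) := by
    rw [symbolPoly_conormal hhom, Finset.sum_eq_single_of_mem (2 * m)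
      (Finset.mem_Icc.2 ⟨by omega, le_rfl⟩)]
    · simp
    · intro j hj hne
      have : 2 * m - j ≠ 0 := by have := (Finset.mem_Icc.1 hj).2; omega
      simp [this]
  have h2 := eval_symbolPoly_ofReal_ne_zero hell (ξ' := 0) (σ := 1) (Or.inr one_ne_zero) le_rfl
  rw [coeff_symbolPoly_top hhom, h1]
  rw [h1] at h2
  simpa using h2

theorem natDegree_symbolPoly (hμm : μ < m)
    (hhom : ∀ j ∈ Finset.Icc (2 * μ) (2 * m), (A j).IsHomogeneous j)
    (hell : IsNElliptic A m μ) (ξ' : EuclideanSpace ℝ (Fin d)) (lam : ℝ) :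
    (symbolPoly A m μ ξ' lam).natDegree = 2 * m :=
  le_antisymm (natDegree_symbolPoly_le hhom ξ' lam)
    (Polynomial.le_natDegree_of_ne_zero (coeff_symbolPoly_top_ne_zero hμm hhom hell ξ' lam))

/-- The function `ζ ↦ A_j(ζ)` varies little, relative to its natural size, under relatively small
perturbations. -/
theorem exists_aeval_sub_le (s : Finset ℕ) (hhom : ∀ j ∈ s, (A j).IsHomogeneous j)
    {ε : ℝ} (hε : 0 < ε) :
    ∃ δ > 0, ∀ j ∈ s, ∀ ζ ζ' : Fin (d + 1) → ℂ, ‖ζ' - ζ‖ ≤ δ * ‖ζ‖ →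
      ‖MvPolynomial.aeval ζ' (A j) - MvPolynomial.aeval ζ (A j)‖ ≤ ε * ‖ζ‖ ^ j := by
  -- Stated eventually as δ → 0+, so that finitely many `j` can share one δ.
  suffices h : ∀ j ∈ s, ∀ᶠ δ in 𝓝[>] (0 : ℝ), ∀ ζ ζ' : Fin (d + 1) → ℂ, ‖ζ' - ζ‖ ≤ δ * ‖ζ‖ →
      ‖MvPolynomial.aeval ζ' (A j) - MvPolynomial.aeval ζ (A j)‖ ≤ ε * ‖ζ‖ ^ j by
    obtain ⟨δ, h1, h2⟩ := (((Finset.eventually_all s).2 h).and self_mem_nhdsWithin).exists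
    exact ⟨δ, h2, h1⟩
  intro j hj
  have huc := (isCompact_closedBall (0 : Fin (d + 1) → ℂ) 2).uniformContinuousOn_of_continuous
    (continuous_aeval_mvPolynomial (A j)).continuousOn
  obtain ⟨δ, hδ, huc⟩ := Metric.uniformContinuousOn_iff.1 huc ε hε
  filter_upwards [Ioo_mem_nhdsGT (show 0 < min δ 1 by positivity)] with η hη ζ ζ' hζ
  rcases eq_or_ne ζ 0 with rfl | h0
  · have : ζ' = 0 := by simpa using hζ
    subst this
    simp only [sub_self, norm_zero]
    positivity
  have hr : 0 < ‖ζ‖ := norm_pos_iff.2 h0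
  have hr' : (‖ζ‖ : ℂ) ≠ 0 := by exact_mod_cast hr.ne'
  -- Homogeneity reduces the claim to `‖ζ‖ = 1`; as the perturbation is less than 1, both points lie
  -- in the ball of radius 2, where `A j` is uniformly continuous.
  have hscale : ∀ z : Fin (d + 1) → ℂ, MvPolynomial.aeval z (A j) =
      (‖ζ‖ : ℂ) ^ j * MvPolynomial.aeval ((‖ζ‖ : ℂ)⁻¹ • z) (A j) := by
    intro z
    rw [← aeval_mul_of_isHomogeneous (hhom j hj)]
    simp [hr']
  have hd : ‖(‖ζ‖ : ℂ)⁻¹ • ζ' - (‖ζ‖ : ℂ)⁻¹ • ζ‖ ≤ η := by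
    rw [← smul_sub, norm_smul, norm_inv, Complex.norm_real, norm_norm, inv_mul_le_iff₀ hr]
    linarith
  have hn : ‖(‖ζ‖ : ℂ)⁻¹ • ζ‖ = 1 := by
    rw [norm_smul, norm_inv, Complex.norm_real, norm_norm, inv_mul_cancel₀ hr.ne']
  have hη1 : η < δ := hη.2.trans_le (min_le_left _ _)
  have hη2 : η < 1 := hη.2.trans_le (min_le_right _ _)
  have hmain := huc ((‖ζ‖ : ℂ)⁻¹ • ζ')
    (by
      rw [mem_closedBall_zero_iff]
      have := norm_le_norm_add_norm_sub' ((‖ζ‖ : ℂ)⁻¹ • ζ') ((‖ζ‖ : ℂ)⁻¹ • ζ)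
      linarith)
    ((‖ζ‖ : ℂ)⁻¹ • ζ) (by rw [mem_closedBall_zero_iff]; linarith)
    (by rw [dist_eq_norm]; linarith)
  rw [hscale ζ, hscale ζ', ← mul_sub, norm_mul, norm_pow, Complex.norm_real, norm_norm, mul_comm]
  rw [dist_eq_norm] at hmain
  gcongr

/-- Since j ≥ 2μ, each λ^{2m-j}|ζ|^j is at most the weight |ζ|^{2μ}(λ+|ζ|)^{2m-2μ} of N-ellipticity,
and there are at most 2m + 1 terms. Thus δ can be chosen independently of λ. -/
theorem exists_pencil_sub_le
    (hhom : ∀ j ∈ Finset.Icc (2 * μ) (2 * m), (A j).IsHomogeneous j) {ε : ℝ} (hε : 0 < ε) :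
    ∃ δ > 0, ∀ (ζ ζ' : Fin (d + 1) → ℂ) (lam : ℝ), 0 ≤ lam → ‖ζ' - ζ‖ ≤ δ * ‖ζ‖ →
      ‖pencil A m μ ζ' lam - pencil A m μ ζ lam‖
        ≤ ε * ‖ζ‖ ^ (2 * μ) * (lam + ‖ζ‖) ^ (2 * m - 2 * μ) := by
  obtain ⟨δ, hδ, h⟩ := exists_aeval_sub_le (Finset.Icc (2 * μ) (2 * m)) hhom
    (ε := ε / (2 * m + 1)) (by positivity)
  refine ⟨δ, hδ, fun ζ ζ' lam hlam hζ => ?_⟩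
  have hterm : ∀ j ∈ Finset.Icc (2 * μ) (2 * m), ‖(lam : ℂ) ^ (2 * m - j) *
      MvPolynomial.aeval ζ' (A j) - (lam : ℂ) ^ (2 * m - j) * MvPolynomial.aeval ζ (A j)‖ ≤
      ε / (2 * m + 1) * (‖ζ‖ ^ (2 * μ) * (lam + ‖ζ‖) ^ (2 * m - 2 * μ)) := by
    intro j hj
    obtain ⟨h1, h2⟩ := Finset.mem_Icc.1 hj
    rw [← mul_sub, norm_mul, norm_pow, Complex.norm_real, Real.norm_of_nonneg hlam]
    calc lam ^ (2 * m - j) * ‖MvPolynomial.aeval ζ' (A j) - MvPolynomial.aeval ζ (A j)‖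
        ≤ (lam + ‖ζ‖) ^ (2 * m - j) * (ε / (2 * m + 1) * ‖ζ‖ ^ j) := by
          gcongr
          · linarith [norm_nonneg ζ]
          · exact h j hj ζ ζ' hζ
      _ = ε / (2 * m + 1) * (‖ζ‖ ^ (2 * μ) * ((lam + ‖ζ‖) ^ (2 * m - j) * ‖ζ‖ ^ (j - 2 * μ))) := by
          have : ‖ζ‖ ^ j = ‖ζ‖ ^ (2 * μ) * ‖ζ‖ ^ (j - 2 * μ) := by rw [← pow_add]; congr 1; omega
          rw [this]; ring
      _ ≤ ε / (2 * m + 1) * (‖ζ‖ ^ (2 * μ) *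
            ((lam + ‖ζ‖) ^ (2 * m - j) * (lam + ‖ζ‖) ^ (j - 2 * μ))) := by
          gcongr
          linarith
      _ = _ := by
          rw [← pow_add]
          congr 4
          omega
  rw [pencil_complex, pencil_complex, ← Finset.sum_sub_distrib]
  refine (norm_sum_le_of_le _ hterm).trans ?_
  rw [Finset.sum_const, nsmul_eq_mul, Nat.card_Icc]
  set Y := ‖ζ‖ ^ (2 * μ) * (lam + ‖ζ‖) ^ (2 * m - 2 * μ) with hY
  have hY0 : 0 ≤ Y := by positivity
  have hle : ((2 * m + 1 - 2 * μ : ℕ) : ℝ) ≤ 2 * m + 1 := by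
    have : 2 * m + 1 - 2 * μ ≤ 2 * m + 1 := Nat.sub_le _ _
    exact_mod_cast this
  calc ((2 * m + 1 - 2 * μ : ℕ) : ℝ) * (ε / (2 * m + 1) * Y)
      ≤ (2 * m + 1) * (ε / (2 * m + 1) * Y) := by gcongr
    _ = ε * Y := by field_simp
    _ = _ := by rw [hY]; ring

end Symbol

/-! ### Location of the roots -/

section Symbol

variable {d m μ : ℕ} {A : ℕ → MvPolynomial (Fin (d + 1)) ℂ}

theorem norm_covector_ofReal_le (ξ' : EuclideanSpace ℝ (Fin d)) (σ : ℝ) :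
    ‖covector ξ' σ‖ ≤ ‖realCovector ξ' σ‖ := by
  rw [pi_norm_le_iff_of_nonneg (norm_nonneg _)]
  intro i
  rw [← realCovector_coe, Complex.norm_real]
  exact PiLp.norm_apply_le _ i

theorem norm_realCovector_le (ξ' : EuclideanSpace ℝ (Fin d)) (σ : ℝ) :
    ‖realCovector ξ' σ‖ ≤ (d + 1) * ‖covector ξ' σ‖ := by
  rw [← sq_le_sq₀ (norm_nonneg _) (by positivity), EuclideanSpace.norm_sq_eq]
  have h : ∀ i ∈ Finset.univ, ‖realCovector ξ' σ i‖ ^ 2 ≤ ‖covector ξ' σ‖ ^ 2 := by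
    intro i _
    have := norm_le_pi_norm (covector ξ' σ) i
    rw [← realCovector_coe, Complex.norm_real] at this
    rw [← realCovector_coe]
    gcongr
  refine (Finset.sum_le_sum h).trans ?_
  rw [Finset.sum_const, Finset.card_univ, Fintype.card_fin, nsmul_eq_mul, mul_pow]
  push_cast
  gcongr
  nlinarith [(Nat.cast_nonneg d : (0 : ℝ) ≤ d)]

/-- The roots of `A(ξ', τ, lam)` stay away from the real axis. -/
theorem exists_im_root_ge
    (hhom : ∀ j ∈ Finset.Icc (2 * μ) (2 * m), (A j).IsHomogeneous j)
    (hell : IsNElliptic A m μ) :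
    ∃ δ > 0, ∀ (ξ' : EuclideanSpace ℝ (Fin d)) (lam : ℝ) (τ : ℂ), 0 ≤ lam →
      (symbolPoly A m μ ξ' lam).IsRoot τ → δ * (‖ξ'‖ + ‖τ‖) ≤ |τ.im| := by
  obtain ⟨c, hc, hell⟩ := hell
  obtain ⟨δ, hδ, hpert⟩ := exists_pencil_sub_le hhom (half_pos hc)
  -- The constant comes from |ξ'| + |τ| ≤ 2R + |Im τ| together with R ≤ (d + 1)/δ · |Im τ|; the
  -- factor d + 1 compares the Euclidean norm with the supremum norm.
  refine ⟨(2 * (d + 1) / δ + 1)⁻¹, by positivity, fun ξ' lam τ hlam hroot => ?_⟩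
  set R := ‖realCovector ξ' τ.re‖ with hR
  have h1 : ‖ξ'‖ ≤ R := norm_le_norm_realCovector _ _
  have h2 : |τ.re| ≤ R := abs_le_norm_realCovector _ _
  have h3 : ‖τ‖ ≤ |τ.re| + |τ.im| := Complex.norm_le_abs_re_add_abs_im τ
  have h4 : R ≤ (d + 1) * ‖covector ξ' (τ.re : ℂ)‖ := norm_realCovector_le _ _
  have h5 : ‖covector ξ' (τ.re : ℂ)‖ ≤ R := norm_covector_ofReal_le _ _
  set s := ‖covector ξ' (τ.re : ℂ)‖ with hs
  have hs0 : 0 ≤ s := norm_nonneg _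
  suffices h : R ≤ (d + 1) / δ * |τ.im| by
    rw [inv_mul_le_iff₀ (by positivity)]
    calc ‖ξ'‖ + ‖τ‖ ≤ 2 * R + |τ.im| := by linarith
      _ ≤ 2 * ((d + 1) / δ * |τ.im|) + |τ.im| := by gcongr
      _ = _ := by ring
  -- Were Im τ too small, (ξ', τ) would be a small perturbation of the real covector (ξ', Re τ). The
  -- pencil would change by at most half of its elliptic lower bound there, yet it vanishes at (ξ',
  -- τ).
  by_contra! hlt
  have hR0 : 0 < R := lt_of_le_of_lt (by positivity) hlt
  have hsub : ‖covector ξ' τ - covector ξ' (τ.re : ℂ)‖ ≤ δ * s := by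
    rw [pi_norm_le_iff_of_nonneg (by positivity)]
    intro i
    refine Fin.lastCases ?_ (fun i => ?_) i
    · have : τ - (τ.re : ℂ) = (τ.im : ℂ) * Complex.I := by
        rw [sub_eq_iff_eq_add', Complex.re_add_im]
      simp only [covector, Pi.sub_apply, Fin.snoc_last, this, norm_mul, Complex.norm_I, mul_one,
        Complex.norm_real, Real.norm_eq_abs]
      have h6 : (d + 1) / δ * |τ.im| ≤ (d + 1) * s := hlt.le.trans h4
      rw [div_mul_eq_mul_div, div_le_iff₀ hδ] at h6
      have hd : (0 : ℝ) < d + 1 := by positivity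
      nlinarith
    · simp only [covector, Pi.sub_apply, Fin.snoc_castSucc, sub_self, norm_zero]
      positivity
  have hmain := hpert _ _ lam hlam hsub
  rw [Polynomial.IsRoot.def, eval_symbolPoly] at hroot
  rw [hroot, zero_sub, norm_neg] at hmain
  have hlow := pencil_realCovector_ge hell ξ' τ.re hlam
  have hup : c / 2 * s ^ (2 * μ) * (lam + s) ^ (2 * m - 2 * μ) ≤
      c / 2 * R ^ (2 * μ) * (lam + R) ^ (2 * m - 2 * μ) := by gcongr
  have hpos : 0 < c / 2 * R ^ (2 * μ) * (lam + R) ^ (2 * m - 2 * μ) := by positivity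
  have : c * R ^ (2 * μ) * (lam + R) ^ (2 * m - 2 * μ) =
    2 * (c / 2 * R ^ (2 * μ) * (lam + R) ^ (2 * m - 2 * μ)) := by ring
  linarith

/-- A polynomial function does not vanish near a point where it does not vanish. -/
theorem exists_norm_ge_of_continuous {f : ℂ → ℂ} (hf : Continuous f) (h0 : f 0 ≠ 0) :
    ∃ r > 0, ∃ c > 0, ∀ z : ℂ, ‖z‖ ≤ r → c ≤ ‖f z‖ := by
  have h : ∀ᶠ z in 𝓝 (0 : ℂ), ‖f 0‖ / 2 < ‖f z‖ :=
    (hf.norm.tendsto 0).eventually_const_lt (half_lt_self (norm_pos_iff.2 h0))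
  obtain ⟨r, hr, h⟩ := Metric.eventually_nhds_iff.1 h
  refine ⟨r / 2, half_pos hr, ‖f 0‖ / 2, half_pos (norm_pos_iff.2 h0), fun z hz => ?_⟩
  exact (h (by rw [dist_zero_right]; linarith)).le

theorem conormalCoeff_top_ne_zero (hμm : μ < m)
    (hhom : ∀ j ∈ Finset.Icc (2 * μ) (2 * m), (A j).IsHomogeneous j)
    (hell : IsNElliptic A m μ) : conormalCoeff A (2 * m) ≠ 0 := by
  have h := coeff_symbolPoly_top_ne_zero hμm hhom hell 0 0
  rw [symbolPoly_conormal hhom, Polynomial.finsetSum_coeff, Finset.sum_eq_single_of_mem (2 * m)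
    (Finset.mem_Icc.2 ⟨by omega, le_rfl⟩)] at h
  · simpa using h
  · intro j hj hne
    rw [Polynomial.coeff_C_mul_X_pow, if_neg (Ne.symm hne)]

/-- At ξ = 0 ellipticity may say nothing, so the bound is taken in the limit: A(0, s, 1) / s^{2μ}
has modulus at least c for s > 0, and s → 0+ leaves the lowest coefficient. -/
theorem conormalCoeff_bot_ne_zero (hμm : μ < m)
    (hhom : ∀ j ∈ Finset.Icc (2 * μ) (2 * m), (A j).IsHomogeneous j)
    (hell : IsNElliptic A m μ) : conormalCoeff A (2 * μ) ≠ 0 := by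
  obtain ⟨c, hc, hell⟩ := hell
  have hcont : Continuous fun s : ℝ => ‖∑ j ∈ Finset.Icc (2 * μ) (2 * m),
      (s : ℂ) ^ (j - 2 * μ) * conormalCoeff A j‖ := by fun_prop
  have hge : ∀ s ∈ Ioi (0 : ℝ), c ≤ ‖∑ j ∈ Finset.Icc (2 * μ) (2 * m),
      (s : ℂ) ^ (j - 2 * μ) * conormalCoeff A j‖ := by
    intro s hs
    have hs : 0 < s := hs
    have h1 := pencil_realCovector_ge hell 0 s zero_le_one
    have h2 : ‖realCovector (0 : EuclideanSpace ℝ (Fin d)) s‖ = s := by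
      rw [← sq_eq_sq₀ (norm_nonneg _) hs.le, norm_realCovector_sq]
      simp
    have h3 : pencil A m μ (covector (0 : EuclideanSpace ℝ (Fin d)) (s : ℂ)) 1 =
        (s : ℂ) ^ (2 * μ) * ∑ j ∈ Finset.Icc (2 * μ) (2 * m),
          (s : ℂ) ^ (j - 2 * μ) * conormalCoeff A j := by
      rw [pencil_conormal hhom, Finset.mul_sum]
      refine Finset.sum_congr rfl fun j hj => ?_
      rw [← mul_assoc, ← pow_add, Nat.add_sub_cancel' (Finset.mem_Icc.1 hj).1]
      simp
    rw [h2, h3, norm_mul, norm_pow, Complex.norm_real, Real.norm_of_nonneg hs.le] at h1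
    have h4 : 0 < s ^ (2 * μ) := by positivity
    have h5 : 1 ≤ (1 + s) ^ (2 * m - 2 * μ) := one_le_pow₀ (by linarith)
    refine le_of_mul_le_mul_left (le_trans ?_ h1) h4
    nlinarith [mul_pos hc h4]
  have hlim := ge_of_tendsto (hcont.continuousWithinAt (s := Ioi 0) (x := 0))
    (eventually_of_mem self_mem_nhdsWithin hge)
  beta_reduce at hlim
  rw [Finset.sum_eq_single_of_mem (2 * μ) (Finset.mem_Icc.2 ⟨le_rfl, by omega⟩)] at hlim
  · intro h
    simp only [h, mul_zero, norm_zero] at hlim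
    linarith
  · intro j hj hne
    have : j - 2 * μ ≠ 0 := by have := (Finset.mem_Icc.1 hj).1; omega
    simp [this]

/-- For complex τ the bound holds away from |τ| ~ λ: A(0, τ, λ) is τ^{2μ}λ^{2m-2μ} times a
polynomial in τ/λ, or τ^{2m} times a polynomial in λ/τ, and both polynomials have nonzero constant
term. The power of 2 absorbs λ + |τ| ≤ 2 max(λ, |τ|). -/
theorem exists_pencil_conormal_ge (hμm : μ < m)
    (hhom : ∀ j ∈ Finset.Icc (2 * μ) (2 * m), (A j).IsHomogeneous j)
    (hell : IsNElliptic A m μ) :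
    ∃ r > 0, ∃ c > 0, ∀ (τ : ℂ) (lam : ℝ), 0 ≤ lam → τ ≠ 0 →
      (‖τ‖ ≤ r * lam ∨ lam ≤ r * ‖τ‖) →
      c * ‖τ‖ ^ (2 * μ) * (lam + ‖τ‖) ^ (2 * m - 2 * μ) ≤
        ‖pencil A m μ (covector (0 : EuclideanSpace ℝ (Fin d)) τ) lam‖ := by
  obtain ⟨r₁, hr₁, c₁, hc₁, h₁⟩ := exists_norm_ge_of_continuous
    (f := fun z => ∑ j ∈ Finset.Icc (2 * μ) (2 * m), z ^ (j - 2 * μ) * conormalCoeff A j)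
    (by fun_prop) (by
      rw [Finset.sum_eq_single_of_mem (2 * μ) (Finset.mem_Icc.2 ⟨le_rfl, by omega⟩)]
      · simpa using conormalCoeff_bot_ne_zero hμm hhom hell
      · intro j hj hne
        have : j - 2 * μ ≠ 0 := by have := (Finset.mem_Icc.1 hj).1; omega
        simp [this])
  obtain ⟨r₂, hr₂, c₂, hc₂, h₂⟩ := exists_norm_ge_of_continuous
    (f := fun z => ∑ j ∈ Finset.Icc (2 * μ) (2 * m), z ^ (2 * m - j) * conormalCoeff A j)
    (by fun_prop) (by
      rw [Finset.sum_eq_single_of_mem (2 * m) (Finset.mem_Icc.2 ⟨by omega, le_rfl⟩)]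
      · simpa using conormalCoeff_top_ne_zero hμm hhom hell
      · intro j hj hne
        have : 2 * m - j ≠ 0 := by have := (Finset.mem_Icc.1 hj).2; omega
        simp [this])
  have hr0 : 0 < min (min r₁ r₂) 1 := by positivity
  refine ⟨min (min r₁ r₂) 1, hr0, min c₁ c₂ / 2 ^ (2 * m - 2 * μ), by positivity,
    fun τ lam hlam hτ h => ?_⟩
  have hr1 : min (min r₁ r₂) 1 ≤ r₁ := (min_le_left _ _).trans (min_le_left _ _)
  have hr2 : min (min r₁ r₂) 1 ≤ r₂ := (min_le_left _ _).trans (min_le_right _ _)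
  have hr3 : min (min r₁ r₂) 1 ≤ 1 := min_le_right _ _
  set r := min (min r₁ r₂) 1
  have hτ0 : 0 < ‖τ‖ := norm_pos_iff.2 hτ
  have hsplit : ‖τ‖ ^ (2 * m) = ‖τ‖ ^ (2 * μ) * ‖τ‖ ^ (2 * m - 2 * μ) := by
    rw [← pow_add, Nat.add_sub_cancel' (by omega)]
  rcases h with h | h
  · have hlam0 : 0 < lam := by
      by_contra! hle
      nlinarith
    have hlamC : (lam : ℂ) ≠ 0 := by exact_mod_cast hlam0.ne'
    have hle : ‖τ‖ ≤ lam := by nlinarith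
    have hfac : pencil A m μ (covector (0 : EuclideanSpace ℝ (Fin d)) τ) lam =
        τ ^ (2 * μ) * (lam : ℂ) ^ (2 * m - 2 * μ) * ∑ j ∈ Finset.Icc (2 * μ) (2 * m),
          (τ / lam) ^ (j - 2 * μ) * conormalCoeff A j := by
      rw [pencil_conormal hhom, Finset.mul_sum]
      refine Finset.sum_congr rfl fun j hj => ?_
      obtain ⟨hj1, hj2⟩ := Finset.mem_Icc.1 hj
      have e1 : τ ^ j = τ ^ (2 * μ) * τ ^ (j - 2 * μ) := by
        rw [← pow_add, Nat.add_sub_cancel' hj1]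
      have e2 : (lam : ℂ) ^ (2 * m - 2 * μ) =
          (lam : ℂ) ^ (2 * m - j) * (lam : ℂ) ^ (j - 2 * μ) := by
        rw [← pow_add]; congr 1; omega
      rw [e1, e2, div_pow]
      field_simp
    have h6 := h₁ (τ / lam) (by
      rw [norm_div, Complex.norm_real, Real.norm_of_nonneg hlam, div_le_iff₀ hlam0]
      exact h.trans (by gcongr))
    rw [hfac, norm_mul, norm_mul, norm_pow, norm_pow, Complex.norm_real, Real.norm_of_nonneg hlam]
    calc min c₁ c₂ / 2 ^ (2 * m - 2 * μ) * ‖τ‖ ^ (2 * μ) * (lam + ‖τ‖) ^ (2 * m - 2 * μ)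
        ≤ c₁ / 2 ^ (2 * m - 2 * μ) * ‖τ‖ ^ (2 * μ) * (2 * lam) ^ (2 * m - 2 * μ) := by
          gcongr
          · exact min_le_left _ _
          · linarith
      _ = ‖τ‖ ^ (2 * μ) * lam ^ (2 * m - 2 * μ) * c₁ := by
          rw [mul_pow]
          field_simp
      _ ≤ _ := by gcongr
  · have hle : lam ≤ ‖τ‖ := by nlinarith
    have hfac : pencil A m μ (covector (0 : EuclideanSpace ℝ (Fin d)) τ) lam =
        τ ^ (2 * m) * ∑ j ∈ Finset.Icc (2 * μ) (2 * m),
          ((lam : ℂ) / τ) ^ (2 * m - j) * conormalCoeff A j := by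
      rw [pencil_conormal hhom, Finset.mul_sum]
      refine Finset.sum_congr rfl fun j hj => ?_
      obtain ⟨hj1, hj2⟩ := Finset.mem_Icc.1 hj
      have e1 : τ ^ (2 * m) = τ ^ j * τ ^ (2 * m - j) := by
        rw [← pow_add, Nat.add_sub_cancel' hj2]
      rw [e1, div_pow]
      field_simp
    have h6 := h₂ ((lam : ℂ) / τ) (by
      rw [norm_div, Complex.norm_real, Real.norm_of_nonneg hlam, div_le_iff₀ hτ0]
      exact h.trans (by gcongr))
    rw [hfac, norm_mul, norm_pow, hsplit]
    calc min c₁ c₂ / 2 ^ (2 * m - 2 * μ) * ‖τ‖ ^ (2 * μ) * (lam + ‖τ‖) ^ (2 * m - 2 * μ)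
        ≤ c₂ / 2 ^ (2 * m - 2 * μ) * ‖τ‖ ^ (2 * μ) * (2 * ‖τ‖) ^ (2 * m - 2 * μ) := by
          gcongr
          · exact min_le_right _ _
          · linarith
      _ = ‖τ‖ ^ (2 * μ) * ‖τ‖ ^ (2 * m - 2 * μ) * c₂ := by
          rw [mul_pow]
          field_simp
      _ ≤ _ := by gcongr

/-- The roots of `A(ξ', τ, lam)` which are large compared to `ξ'` are of the same order as `lam`. -/
theorem exists_root_comparable (hμm : μ < m)
    (hhom : ∀ j ∈ Finset.Icc (2 * μ) (2 * m), (A j).IsHomogeneous j)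
    (hell : IsNElliptic A m μ) :
    ∃ r > 0, ∃ δ > 0, ∀ (ξ' : EuclideanSpace ℝ (Fin d)) (lam : ℝ) (τ : ℂ), 0 ≤ lam → τ ≠ 0 →
      (symbolPoly A m μ ξ' lam).IsRoot τ → ‖ξ'‖ ≤ δ * ‖τ‖ → r * lam < ‖τ‖ ∧ r * ‖τ‖ < lam := by
  obtain ⟨r, hr, c, hc, hlow⟩ := exists_pencil_conormal_ge hμm hhom hell
  obtain ⟨δ, hδ, hpert⟩ := exists_pencil_sub_le hhom (half_pos hc)
  refine ⟨r, hr, δ, hδ, fun ξ' lam τ hlam hτ hroot hξ => ?_⟩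
  have hτ0 : 0 < ‖τ‖ := norm_pos_iff.2 hτ
  have hn : ‖covector (0 : EuclideanSpace ℝ (Fin d)) τ‖ = ‖τ‖ := by
    refine le_antisymm ((pi_norm_le_iff_of_nonneg (norm_nonneg _)).2 fun i => ?_) ?_
    · refine Fin.lastCases ?_ (fun i => ?_) i <;> simp [covector]
    · simpa [covector] using norm_le_pi_norm (covector (0 : EuclideanSpace ℝ (Fin d)) τ)
        (Fin.last d)
  have hsub : ‖covector ξ' τ - covector (0 : EuclideanSpace ℝ (Fin d)) τ‖ ≤ ‖ξ'‖ := by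
    rw [pi_norm_le_iff_of_nonneg (norm_nonneg _)]
    intro i
    refine Fin.lastCases ?_ (fun i => ?_) i
    · simp [covector]
    · have := PiLp.norm_apply_le ξ' i
      simpa [covector] using this
  -- Here (ξ', τ) is a small perturbation of (0, τ), so A(0, τ, λ) is at most half of the lower
  -- bound which would hold if |τ| and λ were not comparable.
  have hmain := hpert _ _ lam hlam (hsub.trans (hn.symm ▸ hξ))
  rw [Polynomial.IsRoot.def, eval_symbolPoly] at hroot
  rw [hroot, zero_sub, norm_neg, hn] at hmain
  have hpos : 0 < c / 2 * ‖τ‖ ^ (2 * μ) * (lam + ‖τ‖) ^ (2 * m - 2 * μ) := by positivity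
  have hnot : ¬(‖τ‖ ≤ r * lam ∨ lam ≤ r * ‖τ‖) := by
    intro h
    have := hlow τ lam hlam hτ h
    have e : c * ‖τ‖ ^ (2 * μ) * (lam + ‖τ‖) ^ (2 * m - 2 * μ) =
      2 * (c / 2 * ‖τ‖ ^ (2 * μ) * (lam + ‖τ‖) ^ (2 * m - 2 * μ)) := by ring
    linarith
  push Not at hnot
  exact hnot

end Symbol

/-! ### Counting roots in the upper half-plane -/

theorem list_prod_map_eq_prod_range {M : Type*} [CommMonoid M] (f : ℂ → M) (L : List ℂ) :
    (L.map f).prod = ∏ i ∈ Finset.range L.length, f (L.getD i 0) := by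
  induction L with
  | nil => simp
  | cons z L ih =>
    rw [List.length_cons, Finset.prod_range_succ', List.map_cons, List.prod_cons, ih, mul_comm]
    simp

theorem getD_append_mem_left {L₁ L₂ : List ℂ} {i : ℕ} (hi : i < L₁.length) :
    (L₁ ++ L₂).getD i 0 ∈ L₁ := by
  rw [List.getD_append _ _ _ _ hi, List.getD_eq_getElem _ _ hi]
  exact List.getElem_mem hi

theorem getD_append_mem_right {L₁ L₂ : List ℂ} {i : ℕ} (h₁ : L₁.length ≤ i)
    (h₂ : i < L₁.length + L₂.length) : (L₁ ++ L₂).getD i 0 ∈ L₂ := by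
  rw [List.getD_append_right _ _ _ _ h₁, List.getD_eq_getElem _ _ (by omega)]
  exact List.getElem_mem _

section Symbol

variable {d m μ : ℕ} {A : ℕ → MvPolynomial (Fin (d + 1)) ℂ}

theorem im_ne_zero_of_isRoot (hell : IsNElliptic A m μ) {ξ' : EuclideanSpace ℝ (Fin d)}
    {lam : ℝ} {τ : ℂ} (h : ξ' ≠ 0 ∨ τ ≠ 0) (hlam : 0 ≤ lam)
    (hroot : (symbolPoly A m μ ξ' lam).IsRoot τ) : τ.im ≠ 0 := by
  intro him
  have hτ : ((τ.re : ℝ) : ℂ) = τ := Complex.ext (by simp) (by simp [him])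
  refine eval_symbolPoly_ofReal_ne_zero hell (ξ' := ξ') (σ := τ.re) (h.imp_right fun h h0 => h ?_)
    hlam (by rw [hτ]; exact hroot)
  rw [← hτ, h0, Complex.ofReal_zero]

/-- At λ = 0 only `A (2 * m)` survives, and it is even. Passing from ξ' to -ξ' therefore exchanges
upper and lower roots. -/
theorem symbolPoly_neg
    (hhom : ∀ j ∈ Finset.Icc (2 * μ) (2 * m), (A j).IsHomogeneous j)
    (ξ' : EuclideanSpace ℝ (Fin d)) :
    symbolPoly A m μ (-ξ') 0 = (symbolPoly A m μ ξ' 0).comp (-Polynomial.X) := by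
  refine Polynomial.funext fun τ => ?_
  have hc : covector (-ξ') τ = fun i => (-1 : ℂ) * covector ξ' (-τ) i := by
    funext i
    refine Fin.lastCases ?_ (fun i => ?_) i <;> simp [covector]
  rw [Polynomial.eval_comp, Polynomial.eval_neg, Polynomial.eval_X, eval_symbolPoly,
    eval_symbolPoly, hc, pencil_mul hhom, pencil_complex]
  refine Finset.sum_congr rfl fun j hj => ?_
  rcases (Finset.mem_Icc.1 hj).2.lt_or_eq with hlt | rfl
  · have : 2 * m - j ≠ 0 := by omega
    simp [this]
  · simp

open Classical in
theorem numUpperRoots_add_numLowerRoots (p : ℂ[X]) (hp : ∀ z, p.IsRoot z → z.im ≠ 0) :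
    numUpperRoots p + p.roots.countP (fun z => z.im < 0) = p.natDegree := by
  rw [← Polynomial.splits_iff_card_roots.1 (IsAlgClosed.splits p),
    Multiset.card_eq_countP_add_countP (fun z : ℂ => 0 < z.im), numUpperRoots]
  congr 1
  refine Multiset.countP_congr rfl fun z hz => ?_
  have := hp z (Polynomial.isRoot_of_mem_roots hz)
  rw [not_lt]
  exact propext ⟨fun h => h.le, fun h => lt_of_le_of_ne h this⟩

open Classical in
/-- In dimension `d ≥ 2` ellipticity alone forces one half of the roots to lie in the upper half
plane. -/
theorem numUpperRoots_symbolPoly_of_two_le (hd : 2 ≤ d) (hμm : μ < m)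
    (hhom : ∀ j ∈ Finset.Icc (2 * μ) (2 * m), (A j).IsHomogeneous j)
    (hell : IsNElliptic A m μ) {ξ' : EuclideanSpace ℝ (Fin d)} (hξ : ξ' ≠ 0) {lam : ℝ}
    (hlam : 0 ≤ lam) : numUpperRoots (symbolPoly A m μ ξ' lam) = m := by
  let P : Set (EuclideanSpace ℝ (Fin d) × ℝ) := {0}ᶜ ×ˢ Ici 0
  -- This is where d ≥ 2 enters: the punctured space is connected.
  have hconn : IsPreconnected P :=
    (isConnected_compl_singleton_of_one_lt_rank (by
      rw [rank_eq_card_basis (EuclideanSpace.basisFun (Fin d) ℝ).toBasis, Fintype.card_fin]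
      exact_mod_cast hd) 0).isPreconnected.prod isPreconnected_Ici
  have : PreconnectedSpace P := Subtype.preconnectedSpace hconn
  have key := countP_roots_eq (X := P) (N := 2 * m)
    (p := fun x => symbolPoly A m μ x.1.1 x.1.2) (S := {y | 0 < y.2.im}) (T := {y | y.2.im < 0})
    (fun x => natDegree_symbolPoly hμm hhom hell _ _)
    (fun x => coeff_symbolPoly_top_ne_zero hμm hhom hell _ _)
    (fun k => (continuous_coeff_symbolPoly k).comp continuous_subtype_val)
    (isOpen_lt continuous_const (Complex.continuous_im.comp continuous_snd))
    (isOpen_lt (Complex.continuous_im.comp continuous_snd) continuous_const)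
    (disjoint_left.2 fun y (h₁ : 0 < y.2.im) (h₂ : y.2.im < 0) => lt_asymm h₁ h₂)
    (fun x z hz => (im_ne_zero_of_isRoot hell (Or.inl x.2.1) x.2.2 hz).symm.lt_or_gt)
  have hcount : ∀ (η : EuclideanSpace ℝ (Fin d)) (s : ℝ), η ≠ 0 → 0 ≤ s →
      numUpperRoots (symbolPoly A m μ η s) = numUpperRoots (symbolPoly A m μ ξ' lam) := by
    intro η s hη hs
    exact key ⟨(η, s), hη, hs⟩ ⟨(ξ', lam), hξ, hlam⟩
  have h1 := hcount ξ' 0 hξ le_rfl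
  have h2 := hcount (-ξ') 0 (neg_ne_zero.2 hξ) le_rfl
  have h3 := numUpperRoots_add_numLowerRoots (symbolPoly A m μ ξ' 0)
    fun z hz => im_ne_zero_of_isRoot hell (Or.inl hξ) le_rfl hz
  -- The lower roots at ξ' are counted by the upper roots at -ξ', and the two upper counts agree by
  -- connectedness; hence each half-plane has half of the 2m roots.
  have h4 : numUpperRoots (symbolPoly A m μ (-ξ') 0) =
      (symbolPoly A m μ ξ' 0).roots.countP (fun z => z.im < 0) := by
    rw [numUpperRoots, symbolPoly_neg hhom, Polynomial.roots_comp_neg_X, Multiset.countP_map,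
      Multiset.countP_eq_card_filter]
    simp
  rw [natDegree_symbolPoly hμm hhom hell] at h3
  omega

theorem symbolPoly_zero_one
    (hhom : ∀ j ∈ Finset.Icc (2 * μ) (2 * m), (A j).IsHomogeneous j) :
    symbolPoly A m μ (0 : EuclideanSpace ℝ (Fin d)) 1 =
      Polynomial.X ^ (2 * μ) * auxPoly A m μ := by
  have h : Polynomial.X ^ (2 * μ) ∣ symbolPoly A m μ (0 : EuclideanSpace ℝ (Fin d)) 1 := by
    rw [symbolPoly_conormal hhom]
    exact Finset.dvd_sum fun j hj =>
      Dvd.dvd.mul_left (pow_dvd_pow _ (Finset.mem_Icc.1 hj).1) _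
  obtain ⟨q, hq⟩ := h
  rw [auxPoly, hq, Polynomial.mul_divByMonic_cancel_left _ (Polynomial.monic_X_pow _)]

open Classical in
/-- If `lam` is large compared to `ξ'`, then exactly `m - μ` roots in the upper half plane are
of the order of `lam`. -/
theorem countP_large_roots (hμm : μ < m)
    (hhom : ∀ j ∈ Finset.Icc (2 * μ) (2 * m), (A j).IsHomogeneous j)
    (hell : IsNElliptic A m μ) (hdeg : DegeneratesRegularly A m μ) {r δ : ℝ} (hr : 0 < r)
    (hδ : 0 < δ)
    (hcomp : ∀ (ξ' : EuclideanSpace ℝ (Fin d)) (lam : ℝ) (τ : ℂ), 0 ≤ lam → τ ≠ 0 →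
      (symbolPoly A m μ ξ' lam).IsRoot τ → ‖ξ'‖ ≤ δ * ‖τ‖ → r * lam < ‖τ‖ ∧ r * ‖τ‖ < lam)
    {ξ' : EuclideanSpace ℝ (Fin d)} {lam : ℝ} (hlam : 0 < lam) (hξ : ‖ξ'‖ ≤ δ * r * lam) :
    (symbolPoly A m μ ξ' lam).roots.countP (fun z => 0 < z.im ∧ r * lam < ‖z‖) = m - μ := by
  -- A convex set containing (0, 1), to which the count is moved; ξ' = 0 is allowed because λ stays
  -- positive.
  let P : Set (EuclideanSpace ℝ (Fin d) × ℝ) := {x | 0 < x.2 ∧ ‖x.1‖ ≤ δ * r * x.2}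
  have hconv : Convex ℝ P := by
    intro x hx y hy a b ha hb hab
    obtain ⟨hx1, hx2⟩ := hx
    obtain ⟨hy1, hy2⟩ := hy
    refine ⟨?_, ?_⟩
    · simp only [Prod.snd_add, Prod.smul_snd, smul_eq_mul]
      rcases ha.eq_or_lt with rfl | ha'
      · have : b = 1 := by linarith
        subst this
        linarith
      · positivity
    · simp only [Prod.snd_add, Prod.smul_snd, smul_eq_mul, Prod.fst_add, Prod.smul_fst]
      calc ‖a • x.1 + b • y.1‖ ≤ a * ‖x.1‖ + b * ‖y.1‖ := by
            refine (norm_add_le _ _).trans ?_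
            rw [norm_smul, norm_smul, Real.norm_of_nonneg ha, Real.norm_of_nonneg hb]
        _ ≤ a * (δ * r * x.2) + b * (δ * r * y.2) := by gcongr
        _ = _ := by ring
  have : PreconnectedSpace P := Subtype.preconnectedSpace hconv.isPreconnected
  have hc₁ : Continuous fun y : P × ℂ => r * y.1.1.2 := by fun_prop
  have hc₂ : Continuous fun y : P × ℂ => ‖y.2‖ := by fun_prop
  have hc₃ : Continuous fun y : P × ℂ => y.2.im := Complex.continuous_im.comp continuous_snd
  have key := countP_roots_eq (X := P) (N := 2 * m)
    (p := fun x => symbolPoly A m μ x.1.1 x.1.2)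
    (S := {y | 0 < y.2.im ∧ r * y.1.1.2 < ‖y.2‖})
    (T := {y | y.2.im < 0 ∨ ‖y.2‖ < r * y.1.1.2})
    (fun x => natDegree_symbolPoly hμm hhom hell _ _)
    (fun x => coeff_symbolPoly_top_ne_zero hμm hhom hell _ _)
    (fun k => (continuous_coeff_symbolPoly k).comp continuous_subtype_val)
    ((isOpen_lt continuous_const hc₃).inter (isOpen_lt hc₁ hc₂))
    ((isOpen_lt hc₃ continuous_const).union (isOpen_lt hc₂ hc₁))
    (disjoint_left.2 fun y hy hy' => by
      obtain ⟨h1, h2⟩ := hy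
      rcases hy' with h | h <;> linarith)
    (fun x z hz => by
      obtain ⟨⟨η, s⟩, hs, hη⟩ := x
      change (symbolPoly A m μ η s).IsRoot z at hz
      change (0 < z.im ∧ r * s < ‖z‖) ∨ (z.im < 0 ∨ ‖z‖ < r * s)
      -- No root lies on the circle |z| = rλ: in `P`, |z| ≥ rλ implies |ξ'| ≤ δ|z|, and then `hcomp`
      -- makes the inequality strict.
      rcases lt_or_ge ‖z‖ (r * s) with h | h
      · exact Or.inr (Or.inr h)
      have hs : 0 < s := hs
      have hz0 : z ≠ 0 := norm_pos_iff.1 (lt_of_lt_of_le (by positivity) h)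
      have hle : ‖η‖ ≤ δ * ‖z‖ := by
        have hη : ‖η‖ ≤ δ * r * s := hη
        nlinarith
      have := (hcomp η s z hs.le hz0 hz hle).1
      rcases (im_ne_zero_of_isRoot hell (Or.inr hz0) hs.le hz).lt_or_gt with h' | h'
      · exact Or.inr (Or.inl h')
      · exact Or.inl ⟨h', this⟩)
  have h01 : ((0 : EuclideanSpace ℝ (Fin d)), (1 : ℝ)) ∈ P := by
    refine ⟨one_pos, ?_⟩
    simp only [norm_zero]
    positivity
  have hmove : (symbolPoly A m μ ξ' lam).roots.countP (fun z => 0 < z.im ∧ r * lam < ‖z‖) =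
      (symbolPoly A m μ 0 1).roots.countP (fun z => 0 < z.im ∧ r * 1 < ‖z‖) := by
    convert key ⟨(ξ', lam), hlam, hξ⟩ ⟨(0, 1), h01⟩ <;> exact Iff.rfl
  rw [hmove]
  have hne : symbolPoly A m μ (0 : EuclideanSpace ℝ (Fin d)) 1 ≠ 0 := fun h =>
    coeff_symbolPoly_top_ne_zero hμm hhom hell (0 : EuclideanSpace ℝ (Fin d)) 1 (by simp [h])
  have hfac := symbolPoly_zero_one (A := A) hhom
  rw [hfac] at hne
  rw [hfac, Polynomial.roots_mul hne, Polynomial.roots_X_pow, Multiset.countP_add, ← hdeg,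
    numUpperRoots]
  -- The root 0 of multiplicity 2μ is not counted. Every upper root of Q is large, since `hcomp`
  -- applies to all nonzero roots when ξ' = 0.
  have h0 : Multiset.countP (fun z : ℂ => 0 < z.im ∧ r * 1 < ‖z‖) ((2 * μ) • {0}) = 0 := by
    rw [Multiset.countP_nsmul, Multiset.countP_eq_zero.2, mul_zero]
    intro z hz
    rw [Multiset.mem_singleton.1 hz]
    simp
  rw [h0, zero_add]
  refine Multiset.countP_congr rfl fun z hz => propext ⟨fun h => h.1, fun h => ⟨h, ?_⟩⟩
  have hz0 : z ≠ 0 := by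
    rintro rfl
    simp at h
  refine (hcomp 0 1 z zero_le_one hz0 ?_ (by rw [norm_zero]; positivity)).1
  rw [hfac]
  exact (Polynomial.isRoot_of_mem_roots hz).dvd (dvd_mul_left _ _)

/-! ### Splitting the upper roots by their order of magnitude -/

/-- `p` is, up to a factor, the product of `∏ i < m, (X - τ i)`, where the first `μ` roots are of
the order `a` and the remaining ones of the order `b`, quantified by the constant `K`, and a
polynomial with roots in the lower half plane. -/
def SplitsWithOrders (p : ℂ[X]) (m μ : ℕ) (K a b : ℝ) (τ : ℕ → ℂ) : Prop :=
  (∃ (c : ℂ) (s : List ℂ), c ≠ 0 ∧ (∀ z ∈ s, z.im < 0) ∧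
    p = Polynomial.C c * (∏ i ∈ Finset.range m, (Polynomial.X - Polynomial.C (τ i))) *
      (s.map fun z => Polynomial.X - Polynomial.C z).prod) ∧
  (∀ i < μ, ‖τ i‖ ≤ K * a ∧ a ≤ K * (τ i).im) ∧
  ∀ i < m, μ ≤ i → ‖τ i‖ ≤ K * b ∧ b ≤ K * (τ i).im

open Classical in
theorem exists_eq_prod_of_roots_filter_eq {p : ℂ[X]} (hp : p ≠ 0)
    (him : ∀ z, p.IsRoot z → z.im ≠ 0) {L : List ℂ}
    (hL : (L : Multiset ℂ) = p.roots.filter fun z => 0 < z.im) :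
    ∃ (c : ℂ) (s : List ℂ), c ≠ 0 ∧ (∀ z ∈ s, z.im < 0) ∧
      p = Polynomial.C c *
        (∏ i ∈ Finset.range L.length, (Polynomial.X - Polynomial.C (L.getD i 0))) *
        (s.map fun z => Polynomial.X - Polynomial.C z).prod := by
  refine ⟨p.leadingCoeff, (p.roots.filter fun z => ¬ 0 < z.im).toList,
    Polynomial.leadingCoeff_ne_zero.2 hp, fun z hz => ?_, ?_⟩
  · rw [Multiset.mem_toList, Multiset.mem_filter] at hz
    exact lt_of_le_of_ne (not_lt.1 hz.2) (him z (Polynomial.isRoot_of_mem_roots hz.1))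
  · conv_lhs => rw [(IsAlgClosed.splits p).eq_prod_roots]
    rw [mul_assoc, ← list_prod_map_eq_prod_range (fun z => Polynomial.X - Polynomial.C z)]
    congr 1
    conv_lhs => rw [← Multiset.filter_add_not (fun z : ℂ => 0 < z.im) p.roots]
    rw [Multiset.map_add, Multiset.prod_add, ← hL, Multiset.map_coe, Multiset.prod_coe]
    congr 1
    conv_lhs => rw [← Multiset.coe_toList (p.roots.filter fun z => ¬ 0 < z.im)]
    rw [Multiset.map_coe, Multiset.prod_coe]

-- For |ξ'| small against λ, the m - μ large upper roots have order b and the remaining ones cannot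
-- exceed a multiple of a. Otherwise a and b are comparable and any ordering serves. The bounds on
-- imaginary parts come from `exists_im_root_ge`.
open Classical in
theorem exists_splitsWithOrders (hμm : μ < m)
    (hhom : ∀ j ∈ Finset.Icc (2 * μ) (2 * m), (A j).IsHomogeneous j)
    (hell : IsNElliptic A m μ) (hdeg : DegeneratesRegularly A m μ)
    (hroots : d ≤ 1 → ∀ ξ' : EuclideanSpace ℝ (Fin d), ξ' ≠ 0 → ∀ lam : ℝ, 0 ≤ lam →
      numUpperRoots (symbolPoly A m μ ξ' lam) = m) :
    ∃ K ≥ 1, ∀ ξ' : EuclideanSpace ℝ (Fin d), ξ' ≠ 0 → ∀ lam : ℝ, 0 ≤ lam →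
      ∃ τ : ℕ → ℂ, SplitsWithOrders (symbolPoly A m μ ξ' lam) m μ K ‖ξ'‖ (lam + ‖ξ'‖) τ := by
  have hup : ∀ ξ' : EuclideanSpace ℝ (Fin d), ξ' ≠ 0 → ∀ lam : ℝ, 0 ≤ lam →
      numUpperRoots (symbolPoly A m μ ξ' lam) = m := by
    intro ξ' hξ lam hlam
    rcases Nat.lt_or_ge 1 d with h | h
    · exact numUpperRoots_symbolPoly_of_two_le h hμm hhom hell hξ hlam
    · exact hroots h ξ' hξ lam hlam
  obtain ⟨δ₀, hδ₀, him⟩ := exists_im_root_ge hhom hell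
  obtain ⟨r, hr, δ, hδ, hcomp⟩ := exists_root_comparable hμm hhom hell
  have hmax : ∀ (ξ' : EuclideanSpace ℝ (Fin d)) (lam : ℝ) (τ : ℂ), 0 ≤ lam → τ ≠ 0 →
      (symbolPoly A m μ ξ' lam).IsRoot τ → ‖τ‖ ≤ (r⁻¹ + δ⁻¹) * (lam + ‖ξ'‖) := by
    intro ξ' lam τ hlam hτ hroot
    have hn := norm_nonneg ξ'
    have h1 : 0 ≤ r⁻¹ * ‖ξ'‖ := by positivity
    have h2 : 0 ≤ δ⁻¹ * lam := by positivity
    have h3 : 0 ≤ r⁻¹ * lam := by positivity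
    have h4 : 0 ≤ δ⁻¹ * ‖ξ'‖ := by positivity
    rcases le_or_gt ‖ξ'‖ (δ * ‖τ‖) with h | h
    · have := (hcomp ξ' lam τ hlam hτ hroot h).2
      rw [← lt_inv_mul_iff₀ hr] at this
      linarith
    · rw [← lt_inv_mul_iff₀ hδ] at h
      linarith
  -- κ bounds b / a in the second case, where λ < |ξ'| / (δr).
  set κ : ℝ := 1 + (δ * r)⁻¹ with hκ
  have hκ1 : 1 ≤ κ := by
    have : 0 ≤ (δ * r)⁻¹ := by positivity
    linarith
  -- K is the sum of the constants needed in the two cases, increased by 1.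
  set K : ℝ := 1 + (r⁻¹ + δ⁻¹) * κ + δ₀⁻¹ * κ + δ₀⁻¹ * r⁻¹ * (1 + δ * r) with hK
  have hK1 : (r⁻¹ + δ⁻¹) * κ ≤ K := by
    have : 0 ≤ δ₀⁻¹ * κ := by positivity
    have : 0 ≤ δ₀⁻¹ * r⁻¹ * (1 + δ * r) := by positivity
    linarith
  have hK2 : δ₀⁻¹ * κ ≤ K := by
    have : 0 ≤ (r⁻¹ + δ⁻¹) * κ := by positivity
    have : 0 ≤ δ₀⁻¹ * r⁻¹ * (1 + δ * r) := by positivity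
    linarith
  have hK3 : δ₀⁻¹ * r⁻¹ * (1 + δ * r) ≤ K := by
    have : 0 ≤ (r⁻¹ + δ⁻¹) * κ := by positivity
    have : 0 ≤ δ₀⁻¹ * κ := by positivity
    linarith
  have hK4 : r⁻¹ + δ⁻¹ ≤ K := by
    refine le_trans ?_ hK1
    exact le_mul_of_one_le_right (by positivity) hκ1
  have hK5 : δ₀⁻¹ ≤ K := (le_mul_of_one_le_right (by positivity) hκ1).trans hK2
  have hK0 : 1 ≤ K := by
    have : 0 ≤ (r⁻¹ + δ⁻¹) * κ := by positivity
    have : 0 ≤ δ₀⁻¹ * κ := by positivity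
    have : 0 ≤ δ₀⁻¹ * r⁻¹ * (1 + δ * r) := by positivity
    linarith
  refine ⟨K, hK0, fun ξ' hξ lam hlam => ?_⟩
  have ha : 0 < ‖ξ'‖ := norm_pos_iff.2 hξ
  set p := symbolPoly A m μ ξ' lam with hp
  have hp0 : p ≠ 0 := fun h => coeff_symbolPoly_top_ne_zero hμm hhom hell ξ' lam (by simp [← hp, h])
  have hpim : ∀ z, p.IsRoot z → z.im ≠ 0 := fun z hz =>
    im_ne_zero_of_isRoot hell (Or.inl hξ) hlam hz
  have hcard : Multiset.card (p.roots.filter fun z => 0 < z.im) = m := by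
    rw [← Multiset.countP_eq_card_filter]
    exact hup ξ' hξ lam hlam
  have himpos : ∀ z, p.IsRoot z → 0 < z.im → ‖ξ'‖ + ‖z‖ ≤ δ₀⁻¹ * z.im := by
    intro z hz hz'
    rw [← abs_of_pos hz', le_inv_mul_iff₀ hδ₀]
    simpa only [abs_of_pos hz'] using him ξ' lam z hlam hz
  have hne0 : ∀ z : ℂ, 0 < z.im → z ≠ 0 := by
    rintro _ h rfl
    simp at h
  rcases le_or_gt ‖ξ'‖ (δ * r * lam) with hle | hgt
  · have hlam0 : 0 < lam := by
      by_contra! h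
      have : δ * r * lam ≤ 0 := mul_nonpos_of_nonneg_of_nonpos (by positivity) h
      linarith
    have hbig := countP_large_roots hμm hhom hell hdeg hr hδ hcomp hlam0 hle
    set U := p.roots.filter fun z => 0 < z.im with hU
    set Ub := U.filter fun z => r * lam < ‖z‖ with hUb
    set Us := U.filter fun z => ¬ r * lam < ‖z‖ with hUs
    have hUbc : Multiset.card Ub = m - μ := by
      rw [← hbig, Multiset.countP_eq_card_filter, hUb, hU, Multiset.filter_filter]
      simp only [and_comm]
      rfl
    have hUsc : Multiset.card Us = μ := by
      have : Multiset.card Ub + Multiset.card Us = m := by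
        rw [← Multiset.card_add, hUb, hUs, Multiset.filter_add_not, hcard]
      omega
    have hL : ((Us.toList ++ Ub.toList : List ℂ) : Multiset ℂ) = U := by
      rw [← Multiset.coe_add, Multiset.coe_toList, Multiset.coe_toList, add_comm, hUb, hUs,
        Multiset.filter_add_not]
    have hlen : (Us.toList ++ Ub.toList).length = m := by
      rw [List.length_append, Multiset.length_toList, Multiset.length_toList, hUsc, hUbc]
      omega
    have hfac := exists_eq_prod_of_roots_filter_eq hp0 hpim hL
    rw [hlen] at hfac
    refine ⟨fun i => (Us.toList ++ Ub.toList).getD i 0, hfac, fun i hi => ?_, fun i hi hi' => ?_⟩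
    · have hmem := getD_append_mem_left (L₁ := Us.toList) (L₂ := Ub.toList) (i := i)
        (by rw [Multiset.length_toList, hUsc]; exact hi)
      beta_reduce
      set z := (Us.toList ++ Ub.toList).getD i 0
      rw [Multiset.mem_toList, hUs, hU, Multiset.mem_filter, Multiset.mem_filter] at hmem
      obtain ⟨⟨hz1, hz2⟩, hz3⟩ := hmem
      have hz := Polynomial.isRoot_of_mem_roots hz1
      have h1 := himpos z hz hz2
      constructor
      -- A root exceeding K|ξ'| would fall under `hcomp` and hence be large, but it belongs to the
      -- roots that are not.
      · by_contra! hlt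
        refine hz3 (hcomp ξ' lam z hlam (hne0 z hz2) hz ?_).1
        rw [← inv_mul_le_iff₀ hδ]
        refine le_trans ?_ hlt.le
        refine mul_le_mul_of_nonneg_right (le_trans ?_ hK4) ha.le
        have : 0 ≤ r⁻¹ := by positivity
        linarith
      · have : δ₀⁻¹ * z.im ≤ K * z.im := by gcongr
        have := norm_nonneg z
        linarith
    · have hmem := getD_append_mem_right (L₁ := Us.toList) (L₂ := Ub.toList) (i := i)
        (by rw [Multiset.length_toList, hUsc]; exact hi')
        (by rw [Multiset.length_toList, Multiset.length_toList, hUsc, hUbc]; omega)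
      beta_reduce
      set z := (Us.toList ++ Ub.toList).getD i 0
      rw [Multiset.mem_toList, hUb, hU, Multiset.mem_filter, Multiset.mem_filter] at hmem
      obtain ⟨⟨hz1, hz2⟩, hz3⟩ := hmem
      have hz := Polynomial.isRoot_of_mem_roots hz1
      have h1 := himpos z hz hz2
      refine ⟨(hmax ξ' lam z hlam (hne0 z hz2) hz).trans (by gcongr), ?_⟩
      calc lam + ‖ξ'‖ ≤ (1 + δ * r) * lam := by linarith
        _ ≤ (1 + δ * r) * (r⁻¹ * ‖z‖) := by
            gcongr
            rw [le_inv_mul_iff₀ hr]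
            exact hz3.le
        _ ≤ (1 + δ * r) * (r⁻¹ * (δ₀⁻¹ * z.im)) := by
            gcongr
            linarith
        _ = δ₀⁻¹ * r⁻¹ * (1 + δ * r) * z.im := by ring
        _ ≤ K * z.im := by gcongr
  · have hb : lam + ‖ξ'‖ ≤ κ * ‖ξ'‖ := by
      rw [hκ, add_mul, one_mul, add_comm, inv_mul_eq_div, ← sub_nonneg]
      have : lam ≤ ‖ξ'‖ / (δ * r) := by
        rw [le_div_iff₀ (by positivity)]
        linarith
      linarith
    set U := p.roots.filter fun z => 0 < z.im with hU
    have hfac := exists_eq_prod_of_roots_filter_eq hp0 hpim (Multiset.coe_toList U)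
    rw [Multiset.length_toList, hcard] at hfac
    have hall : ∀ i < m, ‖U.toList.getD i 0‖ ≤ K * ‖ξ'‖ ∧
        lam + ‖ξ'‖ ≤ K * (U.toList.getD i 0).im := by
      intro i hi
      have hmem : U.toList.getD i 0 ∈ U := by
        have hi' : i < U.toList.length := by rwa [Multiset.length_toList, hcard]
        rw [← Multiset.mem_toList, List.getD_eq_getElem _ _ hi']
        exact List.getElem_mem _
      set z := U.toList.getD i 0
      rw [hU, Multiset.mem_filter] at hmem
      obtain ⟨hz1, hz2⟩ := hmem
      have hz := Polynomial.isRoot_of_mem_roots hz1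
      have h1 := himpos z hz hz2
      constructor
      · calc ‖z‖ ≤ (r⁻¹ + δ⁻¹) * (lam + ‖ξ'‖) := hmax ξ' lam z hlam (hne0 z hz2) hz
          _ ≤ (r⁻¹ + δ⁻¹) * (κ * ‖ξ'‖) := by gcongr
          _ = (r⁻¹ + δ⁻¹) * κ * ‖ξ'‖ := by ring
          _ ≤ K * ‖ξ'‖ := by gcongr
      · have hzn := norm_nonneg z
        calc lam + ‖ξ'‖ ≤ κ * ‖ξ'‖ := hb
          _ ≤ κ * (δ₀⁻¹ * z.im) := by
              gcongr
              linarith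
          _ = δ₀⁻¹ * κ * z.im := by ring
          _ ≤ K * z.im := by gcongr
    refine ⟨fun i => U.toList.getD i 0, hfac, fun i hi => ?_, fun i hi _ => ?_⟩
    · obtain ⟨h1, h2⟩ := hall i (hi.trans hμm)
      exact ⟨h1, by linarith⟩
    · obtain ⟨h1, h2⟩ := hall i hi
      exact ⟨h1.trans (by gcongr; linarith), h2⟩

end Symbol

/-! ### The operator D as an endomorphism of a space of smooth functions -/

open TopologicalSpace (Opens)

/-- Smooth functions on an open set of real numbers, extended by zero. -/
def smoothFun (U : Opens ℝ) : Submodule ℂ (ℝ → ℂ) where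
  carrier := {u | ContDiffOn ℝ ∞ u U ∧ ∀ t ∉ U, u t = 0}
  add_mem' hu hv := ⟨hu.1.add hv.1, fun t ht => by simp [hu.2 t ht, hv.2 t ht]⟩
  zero_mem' := ⟨contDiffOn_const, fun _ _ => rfl⟩
  smul_mem' c _ hu := ⟨hu.1.const_smul c, fun t ht => by simp [hu.2 t ht]⟩

theorem commute_sub_algebraMap {R : Type*} [Ring R] [Algebra ℂ R] {a b : R} (h : Commute a b)
    (z w : ℂ) : Commute (a - algebraMap ℂ R z) (b - algebraMap ℂ R w) :=
  ((h.sub_right (Algebra.commute_algebraMap_right w _)).sub_left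
    (Algebra.commute_algebraMap_left z _))

namespace smoothFun

variable {U : Opens ℝ}

theorem contDiffOn (u : smoothFun U) : ContDiffOn ℝ ∞ u.1 U := u.2.1

theorem differentiableAt (u : smoothFun U) {t : ℝ} (ht : t ∈ U) : DifferentiableAt ℝ u.1 t :=
  ((contDiffOn u).differentiableOn (by simp)).differentiableAt (U.isOpen.mem_nhds ht)

theorem ext_on {u v : smoothFun U} (h : ∀ t ∈ U, u.1 t = v.1 t) : u = v := by
  refine Subtype.ext (funext fun t => ?_)
  by_cases ht : t ∈ U
  · exact h t ht
  · rw [u.2.2 t ht, v.2.2 t ht]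

open Classical in
/-- The restriction of a function to an open set. -/
def restrict (U : Opens ℝ) (f : ℝ → ℂ) (hf : ContDiffOn ℝ ∞ f U) : smoothFun U :=
  ⟨fun t => if t ∈ U then f t else 0, hf.congr fun _ ht => if_pos ht, fun _ ht => if_neg ht⟩

theorem restrict_apply {f : ℝ → ℂ} (hf : ContDiffOn ℝ ∞ f U) {t : ℝ} (ht : t ∈ U) :
    (restrict U f hf).1 t = f t := if_pos ht

theorem restrict_eventuallyEq {f : ℝ → ℂ} (hf : ContDiffOn ℝ ∞ f U) {t : ℝ} (ht : t ∈ U) :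
    (restrict U f hf).1 =ᶠ[𝓝 t] f :=
  eventually_of_mem (U.isOpen.mem_nhds ht) fun _ hs => restrict_apply hf hs

theorem contDiffOn_deriv (u : smoothFun U) :
    ContDiffOn ℝ ∞ (fun t => -Complex.I * deriv u.1 t) U :=
  contDiffOn_const.mul ((contDiffOn_infty_iff_deriv_of_isOpen U.isOpen).1 (contDiffOn u)).2

/-- The operator `D = -i d/dt`. -/
def diffOp (U : Opens ℝ) : Module.End ℂ (smoothFun U) where
  toFun u := restrict U (fun t => -Complex.I * deriv u.1 t) (contDiffOn_deriv u)
  map_add' u v := ext_on fun t ht => by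
    have h : deriv (u.1 + v.1) t = deriv u.1 t + deriv v.1 t :=
      deriv_add (differentiableAt u ht) (differentiableAt v ht)
    simp only [Submodule.coe_add, Pi.add_apply, restrict_apply _ ht, h, mul_add]
  map_smul' c u := ext_on fun t ht => by
    have h : deriv (c • u.1) t = c • deriv u.1 t := deriv_const_smul c (differentiableAt u ht)
    simp only [Submodule.coe_smul, Pi.smul_apply, restrict_apply _ ht, h, smul_eq_mul,
      RingHom.id_apply]
    ring

theorem diffOp_apply (u : smoothFun U) {t : ℝ} (ht : t ∈ U) :
    (diffOp U u).1 t = -Complex.I * deriv u.1 t := restrict_apply (contDiffOn_deriv u) ht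

theorem hasDerivAt (u : smoothFun U) {t : ℝ} (ht : t ∈ U) :
    HasDerivAt u.1 (Complex.I * (diffOp U u).1 t) t := by
  have e : Complex.I * (-Complex.I * deriv u.1 t) = deriv u.1 t := by
    rw [← mul_assoc, mul_neg, Complex.I_mul_I, neg_neg, one_mul]
  rw [diffOp_apply u ht, e]
  exact (differentiableAt u ht).hasDerivAt

theorem diffOp_pow_apply (u : smoothFun U) (k : ℕ) {t : ℝ} (ht : t ∈ U) :
    ((diffOp U ^ k) u).1 t = (-Complex.I) ^ k * iteratedDeriv k u.1 t := by
  induction k generalizing t with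
  | zero => simp
  | succ k ih =>
    have h : ((diffOp U ^ k) u).1 =ᶠ[𝓝 t] fun s => (-Complex.I) ^ k * iteratedDeriv k u.1 s :=
      eventually_of_mem (U.isOpen.mem_nhds ht) fun s hs => ih hs
    rw [pow_succ', Module.End.mul_apply, diffOp_apply _ ht, h.deriv_eq, deriv_const_mul_field,
      iteratedDeriv_succ, pow_succ']
    ring

theorem aeval_diffOp_apply (p : ℂ[X]) (u : smoothFun U) (t : ℝ) :
    (Polynomial.aeval (diffOp U) p u).1 t = p.sum fun k a => a * ((diffOp U ^ k) u).1 t := by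
  rw [Polynomial.aeval_def, Polynomial.eval₂_eq_sum, Polynomial.sum, Polynomial.sum,
    LinearMap.sum_apply, AddSubmonoidClass.coe_finsetSum, Finset.sum_apply]
  rfl

/-- Eigenfunctions of `D` are exponential functions. -/
theorem eq_exp_mul_of_diffOp_eq (hU : IsPreconnected (U : Set ℝ)) {u : smoothFun U} {z : ℂ}
    (h : diffOp U u = z • u) {s t : ℝ} (hs : s ∈ U) (ht : t ∈ U) :
    u.1 t = Complex.exp (Complex.I * z * (t - s)) * u.1 s := by
  have hd : ∀ x ∈ U, HasDerivAt (fun x : ℝ => Complex.exp (-(Complex.I * z) * x) * u.1 x) 0 x := by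
    intro x hx
    have h1 : HasDerivAt u.1 (Complex.I * (z * u.1 x)) x := by
      have := hasDerivAt u hx
      rwa [h] at this
    have h2 : HasDerivAt (fun x : ℝ => Complex.exp (-(Complex.I * z) * x))
        (Complex.exp (-(Complex.I * z) * x) * (-(Complex.I * z) * 1)) x :=
      ((Complex.ofRealCLM.hasDerivAt (x := x)).const_mul (-(Complex.I * z))).cexp
    refine (h2.mul h1).congr_deriv ?_
    ring
  have hconst := U.isOpen.is_const_of_deriv_eq_zero hU
    (fun x hx => (hd x hx).differentiableAt.differentiableWithinAt)
    (fun x hx => (hd x hx).deriv) hs ht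
  have e : Complex.exp (Complex.I * z * t) * Complex.exp (-(Complex.I * z) * t) = 1 := by
    rw [← Complex.exp_add]
    simp
  calc u.1 t = Complex.exp (Complex.I * z * t) *
        (Complex.exp (-(Complex.I * z) * t) * u.1 t) := by rw [← mul_assoc, e, one_mul]
    _ = Complex.exp (Complex.I * z * t) * (Complex.exp (-(Complex.I * z) * s) * u.1 s) := by
        rw [← hconst]
    _ = _ := by
        have e' : Complex.I * z * (t - s) = Complex.I * z * t + -(Complex.I * z) * s := by ring
        rw [e', Complex.exp_add, mul_assoc (Complex.exp _)]

/-- The operator `∏ (D - z)`, where `z` runs through a list. -/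
def diffProd (U : Opens ℝ) (L : List ℂ) : Module.End ℂ (smoothFun U) :=
  (L.map fun z => diffOp U - algebraMap ℂ (Module.End ℂ (smoothFun U)) z).prod

theorem aeval_prod_X_sub_C (L : List ℂ) :
    Polynomial.aeval (diffOp U) (L.map fun z => Polynomial.X - Polynomial.C z).prod =
      diffProd U L := by
  rw [map_list_prod, List.map_map, diffProd]
  congr 2
  funext z
  simp

theorem commute_diffOp_sub (z w : ℂ) :
    Commute (diffOp U - algebraMap ℂ (Module.End ℂ (smoothFun U)) z)
      (diffOp U - algebraMap ℂ (Module.End ℂ (smoothFun U)) w) :=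
  commute_sub_algebraMap (R := Module.End ℂ (smoothFun U)) (Commute.refl _) z w

theorem diffProd_cons_apply (z : ℂ) (L : List ℂ) (u : smoothFun U) :
    diffProd U (z :: L) u = diffProd U L (diffOp U u - z • u) := by
  have h : Commute (diffOp U - algebraMap ℂ (Module.End ℂ (smoothFun U)) z) (diffProd U L) := by
    refine Commute.list_prod_right _ _ fun x hx => ?_
    obtain ⟨w, -, rfl⟩ := List.mem_map.1 hx
    exact commute_diffOp_sub z w
  have e : diffProd U (z :: L) =
      (diffOp U - algebraMap ℂ (Module.End ℂ (smoothFun U)) z) * diffProd U L := by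
    simp [diffProd]
  rw [e, h.eq, Module.End.mul_apply]
  rfl

end smoothFun

/-! ### Translation by 1 and decaying solutions -/

/-- The open half-line `(0, ∞)`. -/
def halfLine : Opens ℝ := ⟨Ioi 0, isOpen_Ioi⟩

theorem mem_halfLine {t : ℝ} : t ∈ halfLine ↔ 0 < t := Iff.rfl

namespace smoothFun

theorem contDiffOn_comp_add_one (u : smoothFun halfLine) :
    ContDiffOn ℝ ∞ (fun t => u.1 (t + 1)) halfLine :=
  (contDiffOn u).comp (contDiff_id.add contDiff_const).contDiffOn fun t (ht : 0 < t) =>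
    show 0 < t + 1 by linarith

/-- The translation `u ↦ u(· + 1)` on functions on the half-line. -/
def shift : Module.End ℂ (smoothFun halfLine) where
  toFun u := restrict halfLine (fun t => u.1 (t + 1)) (contDiffOn_comp_add_one u)
  map_add' u v := ext_on fun t ht => by
    simp only [Submodule.coe_add, Pi.add_apply, restrict_apply _ ht]
  map_smul' c u := ext_on fun t ht => by
    simp only [Submodule.coe_smul, Pi.smul_apply, restrict_apply _ ht, RingHom.id_apply]

theorem shift_apply (u : smoothFun halfLine) {t : ℝ} (ht : 0 < t) :
    (shift u).1 t = u.1 (t + 1) :=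
  restrict_apply (contDiffOn_comp_add_one u) ht

theorem commute_shift_diffOp : Commute shift (diffOp halfLine) := by
  refine LinearMap.ext fun u => ext_on fun t ht => ?_
  have ht0 : 0 < t := ht
  have h1 : (shift u).1 =ᶠ[𝓝 t] fun s => u.1 (s + 1) :=
    restrict_eventuallyEq (contDiffOn_comp_add_one u) ht
  rw [Module.End.mul_apply, Module.End.mul_apply, shift_apply _ ht0, diffOp_apply _ ht,
    diffOp_apply u (mem_halfLine.2 (by linarith)), h1.deriv_eq, deriv_comp_add_const]

/-- The operator `∏ (T - exp(iz))`, where `T` is the translation by `1` and `z` runs through a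
list. -/
def shiftProd (L : List ℂ) : Module.End ℂ (smoothFun halfLine) :=
  (L.map fun z => shift - algebraMap ℂ (Module.End ℂ (smoothFun halfLine))
    (Complex.exp (Complex.I * z))).prod

theorem commute_shift_sub_diffOp_sub (c w : ℂ) :
    Commute (shift - algebraMap ℂ (Module.End ℂ (smoothFun halfLine)) c)
      (diffOp halfLine - algebraMap ℂ (Module.End ℂ (smoothFun halfLine)) w) :=
  commute_sub_algebraMap (R := Module.End ℂ (smoothFun halfLine)) commute_shift_diffOp c w

theorem commute_shift_sub_diffProd (c : ℂ) (L : List ℂ) :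
    Commute (shift - algebraMap ℂ (Module.End ℂ (smoothFun halfLine)) c) (diffProd halfLine L) := by
  refine Commute.list_prod_right _ _ fun x hx => ?_
  obtain ⟨w, -, rfl⟩ := List.mem_map.1 hx
  exact commute_shift_sub_diffOp_sub c w

theorem commute_shiftProd_diffProd (L L' : List ℂ) :
    Commute (shiftProd L) (diffProd halfLine L') := by
  refine Commute.list_prod_left _ _ fun x hx => ?_
  obtain ⟨w, -, rfl⟩ := List.mem_map.1 hx
  exact commute_shift_sub_diffProd _ L'

theorem shiftProd_cons_apply (z : ℂ) (L : List ℂ) (u : smoothFun halfLine) :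
    shiftProd (z :: L) u = shiftProd L (shift u - Complex.exp (Complex.I * z) • u) := by
  have h : Commute (shift - algebraMap ℂ (Module.End ℂ (smoothFun halfLine))
      (Complex.exp (Complex.I * z))) (shiftProd L) := by
    refine Commute.list_prod_right _ _ fun x hx => ?_
    obtain ⟨w, -, rfl⟩ := List.mem_map.1 hx
    exact commute_sub_algebraMap (R := Module.End ℂ (smoothFun halfLine)) (Commute.refl _) _ _
  have e : shiftProd (z :: L) = (shift - algebraMap ℂ (Module.End ℂ (smoothFun halfLine))
      (Complex.exp (Complex.I * z))) * shiftProd L := by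
    simp [shiftProd]
  rw [e, h.eq, Module.End.mul_apply]
  rfl

theorem shift_eq_of_diffOp_eq {u : smoothFun halfLine} {z : ℂ} (h : diffOp halfLine u = z • u) :
    shift u = Complex.exp (Complex.I * z) • u := by
  refine ext_on fun t ht => ?_
  have ht0 : 0 < t := ht
  rw [shift_apply u ht0, eq_exp_mul_of_diffOp_eq isPreconnected_Ioi h ht
    (mem_halfLine.2 (by linarith : 0 < t + 1))]
  simp

/-- The kernel of D - z consists of multiples of exp(izt), on which T acts as exp(iz). Since T
commutes with D, the factors can be exchanged one at a time. -/
theorem shiftProd_eq_zero_of_diffProd_eq_zero {L : List ℂ} {u : smoothFun halfLine}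
    (h : diffProd halfLine L u = 0) : shiftProd L u = 0 := by
  induction L generalizing u with
  | nil => simpa [diffProd, shiftProd] using h
  | cons z L ih =>
    rw [shiftProd_cons_apply]
    refine ih ?_
    have e : diffProd halfLine (z :: L) = (diffOp halfLine -
        algebraMap ℂ (Module.End ℂ (smoothFun halfLine)) z) * diffProd halfLine L := by
      simp [diffProd]
    rw [e, Module.End.mul_apply] at h
    have h1 : diffOp halfLine (diffProd halfLine L u) = z • diffProd halfLine L u :=
      sub_eq_zero.1 h
    have h2 := congrArg (fun f => f u)
      (commute_shift_sub_diffProd (Complex.exp (Complex.I * z)) L).eq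
    have h3 : shift (diffProd halfLine L u) - Complex.exp (Complex.I * z) •
        diffProd halfLine L u = 0 := sub_eq_zero.2 (shift_eq_of_diffOp_eq h1)
    exact h2.symm.trans h3

/-- `u(t + k) → 0` along the natural numbers. -/
def Vanishing (u : smoothFun halfLine) : Prop :=
  ∀ t > 0, Tendsto (fun k : ℕ => u.1 (t + k)) atTop (𝓝 0)

theorem Vanishing.shift_sub {u : smoothFun halfLine} (hu : Vanishing u) (c : ℂ) :
    Vanishing (shift u - c • u) := by
  intro t ht
  have h1 : Tendsto (fun k : ℕ => u.1 (t + 1 + k)) atTop (𝓝 0) := hu (t + 1) (by linarith)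
  have h2 : Tendsto (fun k : ℕ => u.1 (t + 1 + k) - c * u.1 (t + k)) atTop (𝓝 (0 - c * 0)) :=
    h1.sub ((hu t ht).const_mul c)
  rw [mul_zero, sub_zero] at h2
  refine h2.congr fun k => ?_
  have : (shift u).1 (t + k) = u.1 (t + 1 + k) := by
    rw [shift_apply u (by positivity), add_right_comm]
  rw [← this]
  rfl

theorem Vanishing.shiftProd {u : smoothFun halfLine} (hu : Vanishing u) (L : List ℂ) :
    Vanishing (shiftProd L u) := by
  induction L generalizing u with
  | nil => simpa [smoothFun.shiftProd] using hu
  | cons z L ih =>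
    rw [shiftProd_cons_apply]
    exact ih (hu.shift_sub _)

theorem norm_exp_I_mul (z : ℂ) : ‖Complex.exp (Complex.I * z)‖ = Real.exp (-z.im) := by
  rw [Complex.norm_exp]
  simp

/-- For Im z < 0 the sequence u(t + k) = exp(iz)^k u(t) does not decrease in modulus, so it can tend
to zero only if u(t) = 0. -/
theorem eq_zero_of_shiftProd_eq_zero {L : List ℂ} (hL : ∀ z ∈ L, z.im < 0)
    {u : smoothFun halfLine} (h : shiftProd L u = 0) (hu : Vanishing u) : u = 0 := by
  induction L generalizing u with
  | nil => simpa [shiftProd] using h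
  | cons z L ih =>
    rw [shiftProd_cons_apply] at h
    have h1 := ih (fun w hw => hL w (List.mem_cons_of_mem _ hw)) h (hu.shift_sub _)
    have h2 : shift u = Complex.exp (Complex.I * z) • u := sub_eq_zero.1 h1
    refine ext_on fun t ht => ?_
    have ht0 : 0 < t := ht
    have h3 : ∀ k : ℕ, u.1 (t + k) = Complex.exp (Complex.I * z) ^ k * u.1 t := by
      intro k
      induction k with
      | zero => simp
      | succ k ihk =>
        have h4 := shift_apply u (show 0 < t + k by positivity)
        rw [h2] at h4
        have h5 : u.1 (t + (k + 1 : ℕ)) = Complex.exp (Complex.I * z) * u.1 (t + k) := by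
          rw [Nat.cast_succ, ← add_assoc, ← h4]
          rfl
        rw [h5, ihk, pow_succ']
        ring
    have h6 : 1 ≤ ‖Complex.exp (Complex.I * z)‖ := by
      rw [norm_exp_I_mul, Real.one_le_exp_iff]
      linarith [hL z List.mem_cons_self]
    have h7 := (hu t ht0).norm
    simp only [h3, norm_mul, norm_pow, norm_zero] at h7
    have h8 : ‖u.1 t‖ ≤ 0 := ge_of_tendsto' h7 fun k =>
      le_mul_of_one_le_left (norm_nonneg _) (one_le_pow₀ h6)
    exact norm_le_zero_iff.1 h8

theorem _root_.OdePencil.tendsto_zero_of_recurrence {s f : ℕ → ℂ} {e : ℂ} (he : ‖e‖ < 1)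
    (hf : Tendsto f atTop (𝓝 0)) (h : ∀ k, s (k + 1) = e * s k + f k) :
    Tendsto s atTop (𝓝 0) := by
  rw [Metric.tendsto_atTop]
  intro ε hε
  have he' : 0 < 1 - ‖e‖ := by linarith
  -- With this bound on the forcing, ε/2 is the fixed point of the recursion for the norms.
  obtain ⟨n, hn⟩ := Metric.tendsto_atTop.1 hf (ε / 2 * (1 - ‖e‖)) (by positivity)
  have hbound : ∀ j, ‖s (n + j)‖ ≤ ‖e‖ ^ j * ‖s n‖ + ε / 2 := by
    intro j
    induction j with
    | zero => simpa using (half_pos hε).le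
    | succ j ih =>
      have h1 : ‖f (n + j)‖ ≤ ε / 2 * (1 - ‖e‖) := by
        have := hn (n + j) (by omega)
        rw [dist_zero_right] at this
        exact this.le
      calc ‖s (n + (j + 1))‖ = ‖e * s (n + j) + f (n + j)‖ := by rw [← add_assoc, h]
        _ ≤ ‖e‖ * ‖s (n + j)‖ + ‖f (n + j)‖ := (norm_add_le _ _).trans (by rw [norm_mul])
        _ ≤ ‖e‖ * (‖e‖ ^ j * ‖s n‖ + ε / 2) + ε / 2 * (1 - ‖e‖) := by gcongr
        _ = _ := by ring
  have hpow : Tendsto (fun j : ℕ => ‖e‖ ^ j * ‖s n‖) atTop (𝓝 0) := by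
    simpa using (tendsto_pow_atTop_nhds_zero_of_lt_one (norm_nonneg e) he).mul_const ‖s n‖
  obtain ⟨j₀, hj₀⟩ := eventually_atTop.1 (hpow.eventually_lt_const (half_pos hε))
  refine ⟨n + j₀, fun k hk => ?_⟩
  obtain ⟨j, rfl⟩ := Nat.exists_eq_add_of_le (show n ≤ k by omega)
  rw [dist_zero_right]
  linarith [hbound j, hj₀ j (by omega)]

/-- Removing one factor leaves u(t + k + 1) = exp(iz)u(t + k) + f_k with f_k → 0 by induction, a
contraction because Im z > 0. -/
theorem vanishing_of_shiftProd_eq_zero {L : List ℂ} (hL : ∀ z ∈ L, 0 < z.im)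
    {u : smoothFun halfLine} (h : shiftProd L u = 0) : Vanishing u := by
  induction L generalizing u with
  | nil =>
    have : u = 0 := by simpa [shiftProd] using h
    subst this
    intro t _
    exact tendsto_const_nhds
  | cons z L ih =>
    rw [shiftProd_cons_apply] at h
    have h1 := ih (fun w hw => hL w (List.mem_cons_of_mem _ hw)) h
    intro t ht
    refine tendsto_zero_of_recurrence (e := Complex.exp (Complex.I * z)) ?_ (h1 t ht) fun k => ?_
    · rw [norm_exp_I_mul, Real.exp_lt_one_iff]
      linarith [hL z List.mem_cons_self]
    · have h4 := shift_apply u (show 0 < t + k by positivity)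
      have h5 : (shift u - Complex.exp (Complex.I * z) • u).1 (t + k) =
        (shift u).1 (t + k) - Complex.exp (Complex.I * z) * u.1 (t + k) := rfl
      rw [h5, h4, Nat.cast_succ, ← add_assoc]
      ring

/-- A solution which tends to zero does not involve the roots in the lower half plane. -/
theorem diffProd_eq_zero_of_vanishing {L L' : List ℂ} (hL : ∀ z ∈ L, 0 < z.im)
    (hL' : ∀ z ∈ L', z.im < 0) {u : smoothFun halfLine}
    (h : diffProd halfLine L' (diffProd halfLine L u) = 0) (hu : Vanishing u) :
    diffProd halfLine L u = 0 := by
  -- The translation product for the upper roots preserves decay, and its value is annihilated by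
  -- the product for the lower roots.
  have h1 : shiftProd L u = 0 := by
    refine eq_zero_of_shiftProd_eq_zero hL' ?_ (hu.shiftProd L)
    have h2 : diffProd halfLine (L' ++ L) u = 0 := by
      rw [diffProd, List.map_append, List.prod_append]
      exact h
    have h3 := shiftProd_eq_zero_of_diffProd_eq_zero h2
    rwa [shiftProd, List.map_append, List.prod_append] at h3
  -- Now `diffProd halfLine L u` is killed by both translation products: the upper one makes it
  -- decay, and then the lower one makes it zero.
  refine eq_zero_of_shiftProd_eq_zero hL' (shiftProd_eq_zero_of_diffProd_eq_zero h)
    (vanishing_of_shiftProd_eq_zero hL ?_)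
  have h4 := congrArg (fun f => f u) (commute_shiftProd_diffProd L L).eq
  refine h4.trans ?_
  rw [Module.End.mul_apply, h1, map_zero]

/-- By induction (D - z)u = 0, so u is a multiple of an exponential, and the limit at 0+ makes the
factor zero. The data are limits because these functions live on the open half-line only. -/
theorem eq_zero_of_diffProd_eq_zero {L : List ℂ} {u : smoothFun halfLine}
    (h : diffProd halfLine L u = 0)
    (hu : ∀ k < L.length, Tendsto ((diffOp halfLine ^ k) u).1 (𝓝[>] 0) (𝓝 0)) : u = 0 := by
  induction L generalizing u with
  | nil => simpa [diffProd] using h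
  | cons z L ih =>
    rw [diffProd_cons_apply] at h
    have h1 := ih h fun k hk => by
      have h2 := (hu (k + 1) (by simpa using hk)).sub
        ((hu k (hk.trans (by simp))).const_mul z)
      rw [mul_zero, sub_zero] at h2
      have e : (diffOp halfLine ^ k) (diffOp halfLine u - z • u) =
          (diffOp halfLine ^ (k + 1)) u - z • (diffOp halfLine ^ k) u := by
        rw [map_sub, map_smul, pow_succ, Module.End.mul_apply]
      rw [e]
      exact h2
    have h2 : diffOp halfLine u = z • u := sub_eq_zero.1 h1
    have h3 : Tendsto u.1 (𝓝[>] 0) (𝓝 0) := by simpa using hu 0 (by simp)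
    refine ext_on fun t ht => ?_
    have h4 : Tendsto (fun s : ℝ => Complex.exp (Complex.I * z * (t - s)) * u.1 s) (𝓝[>] 0)
        (𝓝 (Complex.exp (Complex.I * z * (t - (0 : ℝ))) * 0)) := by
      refine Tendsto.mul ?_ h3
      exact tendsto_nhdsWithin_of_tendsto_nhds
        ((by fun_prop : Continuous fun s : ℝ => Complex.exp (Complex.I * z * (t - s))).tendsto 0)
    rw [mul_zero] at h4
    refine tendsto_nhds_unique (tendsto_const_nhds.congr' ?_) h4
    filter_upwards [self_mem_nhdsWithin] with s hs
    exact eq_exp_mul_of_diffOp_eq isPreconnected_Ioi h2 hs ht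

end smoothFun

/-! ### Construction of solutions by a chain of first-order equations -/

namespace smoothFun

theorem contDiff (u : smoothFun ⊤) : ContDiff ℝ ∞ u.1 := contDiffOn_univ.1 (contDiffOn u)

theorem continuous (u : smoothFun ⊤) : Continuous u.1 := (contDiff u).continuous

/-- A smooth function on the real line as an element of `smoothFun ⊤`. -/
def ofContDiff (f : ℝ → ℂ) (hf : ContDiff ℝ ∞ f) : smoothFun ⊤ :=
  ⟨f, hf.contDiffOn, fun t ht => absurd (Set.mem_univ t) ht⟩

/-- Variation of constants: v(t) = exp(izt)(v₀ + ∫₀ᵗ exp(-izs) i f(s) ds). -/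
theorem exists_diffOp_sub_smul_eq (f : smoothFun ⊤) (z v₀ : ℂ) :
    ∃ v : smoothFun ⊤, diffOp ⊤ v - z • v = f ∧ v.1 0 = v₀ := by
  let g : ℝ → ℂ := fun s => Complex.exp (-(Complex.I * z) * s) * (Complex.I * f.1 s)
  let e : ℝ → ℂ := fun t => Complex.exp (Complex.I * z * t)
  have hexp : ∀ c : ℂ, ContDiff ℝ ∞ fun t : ℝ => Complex.exp (c * t) := fun c =>
    (contDiff_const.mul Complex.ofRealCLM.contDiff).cexp
  have hg : ContDiff ℝ ∞ g := (hexp _).mul (contDiff_const.mul (contDiff f))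
  have hGd : ∀ t, HasDerivAt (fun t => ∫ s in (0 : ℝ)..t, g s) (g t) t := fun t =>
    intervalIntegral.integral_hasDerivAt_right (hg.continuous.intervalIntegrable _ _)
      (hg.continuous.stronglyMeasurableAtFilter _ _) hg.continuous.continuousAt
  have hG : ContDiff ℝ ∞ fun t => ∫ s in (0 : ℝ)..t, g s := by
    rw [contDiff_infty_iff_deriv]
    refine ⟨fun t => (hGd t).differentiableAt, ?_⟩
    rwa [show deriv (fun t => ∫ s in (0 : ℝ)..t, g s) = g from funext fun t => (hGd t).deriv]
  refine ⟨ofContDiff (fun t => e t * (v₀ + ∫ s in (0 : ℝ)..t, g s))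
    ((hexp _).mul (contDiff_const.add hG)), ext_on fun t ht => ?_, by simp [ofContDiff, e]⟩
  have he : HasDerivAt e (Complex.exp (Complex.I * z * t) * (Complex.I * z * 1)) t :=
    ((Complex.ofRealCLM.hasDerivAt (x := t)).const_mul (Complex.I * z)).cexp
  have hd := (he.mul ((hGd t).const_add v₀)).deriv
  have hee : Complex.exp (Complex.I * z * t) * Complex.exp (-(Complex.I * z) * t) = 1 := by
    rw [← Complex.exp_add]
    simp
  change (diffOp ⊤ _).1 t - z * (e t * (v₀ + ∫ s in (0 : ℝ)..t, g s)) = f.1 t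
  rw [diffOp_apply _ ht]
  change -Complex.I * deriv (e * fun t => v₀ + ∫ s in (0 : ℝ)..t, g s) t -
    z * (e t * (v₀ + ∫ s in (0 : ℝ)..t, g s)) = f.1 t
  rw [hd]
  simp only [e, g]
  set Y := ∫ s in (0 : ℝ)..t, Complex.exp (-(Complex.I * z) * s) * (Complex.I * f.1 s)
  linear_combination (-(Complex.I * Complex.I) * f.1 t) * hee -
    (f.1 t + z * Complex.exp (Complex.I * z * t) * (v₀ + Y)) * Complex.I_mul_I

/-- The function `(D - τ₀) ⋯ (D - τ_{i-1}) w`. -/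
def chain (τ : ℕ → ℂ) (w : smoothFun ⊤) (i : ℕ) : smoothFun ⊤ :=
  Polynomial.aeval (diffOp ⊤) (∏ s ∈ Finset.range i, (Polynomial.X - Polynomial.C (τ s))) w

@[simp]
theorem chain_zero (τ : ℕ → ℂ) (w : smoothFun ⊤) : chain τ w 0 = w := by simp [chain]

theorem chain_succ (τ : ℕ → ℂ) (w : smoothFun ⊤) (i : ℕ) :
    chain τ w (i + 1) = diffOp ⊤ (chain τ w i) - τ i • chain τ w i := by
  rw [chain, Finset.prod_range_succ, mul_comm, map_mul, Module.End.mul_apply]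
  simp [chain]

theorem diffOp_chain (τ : ℕ → ℂ) (w : smoothFun ⊤) (i : ℕ) :
    diffOp ⊤ (chain τ w i) = chain τ w (i + 1) + τ i • chain τ w i := by
  rw [chain_succ, sub_add_cancel]

/-- The equation for f = (D - τ₀)w, with the roots and data shifted by one, is solved first; then w
is recovered from one first-order equation. Repeated roots need no separate treatment. -/
theorem exists_chain (m : ℕ) (τ c : ℕ → ℂ) :
    ∃ w : smoothFun ⊤, chain τ w m = 0 ∧ ∀ i < m, (chain τ w i).1 0 = c i := by
  induction m generalizing τ c with
  | zero => exact ⟨0, by simp, by simp⟩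
  | succ m ih =>
    obtain ⟨f, hf, hc⟩ := ih (fun i => τ (i + 1)) fun i => c (i + 1)
    obtain ⟨w, hw, hw0⟩ := exists_diffOp_sub_smul_eq f (τ 0) (c 0)
    have hshift : ∀ i, chain τ w (i + 1) = chain (fun i => τ (i + 1)) f i := by
      intro i
      induction i with
      | zero => rw [chain_succ, chain_zero, chain_zero, hw]
      | succ i ihi => rw [chain_succ, ihi, chain_succ]
    refine ⟨w, by rw [hshift, hf], fun i hi => ?_⟩
    cases i with
    | zero => rw [chain_zero, hw0]
    | succ i => rw [hshift, hc i (by omega)]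

/-- Prescribing the values at `0` of `(D - τ₀) ⋯ (D - τ_{i-1}) w` suitably amounts to prescribing
`D ^ l w (0) = δ_{kl}`. -/
theorem diffOp_pow_chain_zero {m k : ℕ} {τ : ℕ → ℂ} {w : smoothFun ⊤}
    (hw : ∀ i < m, (chain τ w i).1 0 =
      (∏ s ∈ Finset.range i, (Polynomial.X - Polynomial.C (τ s))).coeff k)
    (l i : ℕ) (hli : l + i < m) :
    ((diffOp ⊤ ^ l) (chain τ w i)).1 0 = (Polynomial.X ^ l *
      ∏ s ∈ Finset.range i, (Polynomial.X - Polynomial.C (τ s))).coeff k := by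
  induction l generalizing i with
  | zero => simpa using hw i (by omega)
  | succ l ih =>
    -- Both sides obey the recursion coming from X · P_i = P_{i+1} + τ_i P_i, where P_i = ∏_{s<i}(X
    -- - τ_s).
    have h1 : (diffOp ⊤ ^ (l + 1)) (chain τ w i) =
        (diffOp ⊤ ^ l) (chain τ w (i + 1)) + τ i • (diffOp ⊤ ^ l) (chain τ w i) := by
      rw [pow_succ, Module.End.mul_apply, diffOp_chain, map_add, map_smul]
    have h2 : ((diffOp ⊤ ^ (l + 1)) (chain τ w i)).1 0 = ((diffOp ⊤ ^ l) (chain τ w (i + 1))).1 0 +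
        τ i * ((diffOp ⊤ ^ l) (chain τ w i)).1 0 := by
      rw [h1]
      rfl
    rw [h2, ih (i + 1) (by omega), ih i (by omega), ← Polynomial.coeff_C_mul, ← Polynomial.coeff_add,
      Finset.prod_range_succ]
    congr 1
    ring

end smoothFun

/-- Each coefficient is dominated by that of ∏(X + |τ_s|), which is evaluated at x. The free scale x
is later taken to be a or b. -/
theorem norm_coeff_prod_X_sub_C_mul_pow_le (τ : ℕ → ℂ) {x : ℝ} (hx : 0 ≤ x) (i k : ℕ) :
    ‖(∏ s ∈ Finset.range i, (Polynomial.X - Polynomial.C (τ s))).coeff k‖ * x ^ k ≤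
      ∏ s ∈ Finset.range i, (x + ‖τ s‖) := by
  induction i generalizing k with
  | zero =>
    cases k with
    | zero => simp
    | succ k => simp [Polynomial.coeff_one]
  | succ i ih =>
    rw [Finset.prod_range_succ, Finset.prod_range_succ, mul_sub, Polynomial.coeff_sub,
      Polynomial.coeff_mul_C, mul_add]
    refine (mul_le_mul_of_nonneg_right (norm_sub_le _ _) (by positivity)).trans ?_
    rw [add_mul]
    refine add_le_add ?_ ?_
    · cases k with
      | zero =>
        rw [Polynomial.coeff_mul_X_zero, norm_zero, zero_mul]
        exact mul_nonneg (Finset.prod_nonneg fun _ _ => by positivity) hx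
      | succ k =>
        rw [Polynomial.coeff_mul_X, pow_succ, ← mul_assoc]
        exact mul_le_mul_of_nonneg_right (ih k) hx
    · rw [norm_mul, mul_right_comm]
      exact mul_le_mul_of_nonneg_right (ih k) (norm_nonneg _)

/-! ### The energy estimate on the half-line -/

section Energy

theorem eLpNorm_two_le_iff {f : ℝ → ℂ} {ν : Measure ℝ} (hf : MemLp f 2 ν) {M : ℝ} (hM : 0 ≤ M) :
    eLpNorm f 2 ν ≤ ENNReal.ofReal M ↔ ∫ t, ‖f t‖ ^ 2 ∂ν ≤ M ^ 2 := by
  have h0 : 0 ≤ ∫ t, ‖f t‖ ^ 2 ∂ν := integral_nonneg fun t => by positivity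
  rw [hf.eLpNorm_eq_integral_rpow_norm (by norm_num) (by norm_num), ENNReal.ofReal_le_ofReal_iff hM]
  simp only [ENNReal.toReal_ofNat, Real.rpow_ofNat]
  rw [show (2 : ℝ)⁻¹ = 1 / 2 by norm_num, ← Real.sqrt_eq_rpow, Real.sqrt_le_left hM]

theorem integral_sq_le_of_eLpNorm_le {f : ℝ → ℂ} (hf : Continuous f) {M : ℝ} (hM : 0 ≤ M)
    (h : eLpNorm f 2 (volume.restrict (Ioi 0)) ≤ ENNReal.ofReal M) {T : ℝ} (hT : 0 ≤ T) :
    ∫ t in (0 : ℝ)..T, ‖f t‖ ^ 2 ≤ M ^ 2 := by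
  have hmem : MemLp f 2 (volume.restrict (Ioi (0 : ℝ))) :=
    ⟨hf.aestronglyMeasurable, h.trans_lt ENNReal.ofReal_lt_top⟩
  refine le_trans ?_ ((eLpNorm_two_le_iff hmem hM).1 h)
  rw [intervalIntegral.integral_of_le hT]
  exact setIntegral_mono_set ((memLp_two_iff_integrable_sq_norm hf.aestronglyMeasurable).1 hmem)
    (Eventually.of_forall fun t => by positivity) Ioc_subset_Ioi_self.eventuallyLE

theorem eLpNorm_le_of_integral_sq_le {f : ℝ → ℂ} (hf : Continuous f) {M : ℝ} (hM : 0 ≤ M)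
    (h : ∀ T, 0 ≤ T → ∫ t in (0 : ℝ)..T, ‖f t‖ ^ 2 ≤ M ^ 2) :
    eLpNorm f 2 (volume.restrict (Ioi 0)) ≤ ENNReal.ofReal M := by
  have hc : Continuous fun t => ‖f t‖ ^ 2 := by fun_prop
  have hint : IntegrableOn (fun t => ‖f t‖ ^ 2) (Ioi (0 : ℝ)) := by
    refine integrableOn_Ioi_of_intervalIntegral_norm_bounded (M ^ 2) 0 (b := fun T : ℝ => T)
      (l := atTop) (fun T => hc.continuousOn.integrableOn_compact isCompact_Icc |>.mono_set
        Ioc_subset_Icc_self) tendsto_id ?_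
    filter_upwards [eventually_ge_atTop 0] with T hT
    simpa using h T hT
  have hmem : MemLp f 2 (volume.restrict (Ioi (0 : ℝ))) :=
    (memLp_two_iff_integrable_sq_norm hf.aestronglyMeasurable).2 hint
  rw [eLpNorm_two_le_iff hmem hM]
  refine le_of_tendsto (intervalIntegral_tendsto_integral_Ioi 0 hint tendsto_id) ?_
  filter_upwards [eventually_ge_atTop 0] with T hT
  exact h T hT

namespace smoothFun

theorem hasDerivAt_norm_sq (v : smoothFun ⊤) (t : ℝ) :
    HasDerivAt (fun t => ‖v.1 t‖ ^ 2) (2 * inner ℝ (v.1 t) (Complex.I * (diffOp ⊤ v).1 t)) t :=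
  (hasDerivAt v (Set.mem_univ t)).norm_sq

/-- The energy estimate for `(D - z) v = f`. -/
theorem eLpNorm_le_of_diffOp_sub_smul_eq {v f : smoothFun ⊤} {z : ℂ}
    (hvf : diffOp ⊤ v - z • v = f) {η M : ℝ} (hη : 0 < η) (hz : η ≤ z.im) (hM : 0 ≤ M)
    (hf : eLpNorm f.1 2 (volume.restrict (Ioi 0)) ≤ ENNReal.ofReal M) :
    eLpNorm v.1 2 (volume.restrict (Ioi 0)) ≤
      ENNReal.ofReal (‖v.1 0‖ / √η + M / η) := by
  have hv := continuous v
  have hfc := continuous f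
  have hDv : ∀ t, (diffOp ⊤ v).1 t = z * v.1 t + f.1 t := by
    intro t
    rw [← hvf]
    change _ = z * v.1 t + ((diffOp ⊤ v).1 t - z * v.1 t)
    ring
  have hder : ∀ t, HasDerivAt (fun t => ‖v.1 t‖ ^ 2)
      (2 * inner ℝ (v.1 t) (Complex.I * (z * v.1 t + f.1 t))) t := by
    intro t
    rw [← hDv]
    exact hasDerivAt_norm_sq v t
  -- The real part of the equation gives the damping -2 Im z |v|²; half of it absorbs the source by
  -- Young's inequality.
  have hle : ∀ t, 2 * inner ℝ (v.1 t) (Complex.I * (z * v.1 t + f.1 t)) ≤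
      -η * ‖v.1 t‖ ^ 2 + ‖f.1 t‖ ^ 2 / η := by
    intro t
    have h1 : inner ℝ (v.1 t) (Complex.I * (z * v.1 t)) = -z.im * ‖v.1 t‖ ^ 2 := by
      rw [Complex.inner, ← Complex.normSq_eq_norm_sq, Complex.normSq_apply]
      simp
      ring
    have h2 : inner ℝ (v.1 t) (Complex.I * f.1 t) ≤ ‖v.1 t‖ * ‖f.1 t‖ := by
      refine (real_inner_le_norm _ _).trans ?_
      rw [norm_mul, Complex.norm_I, one_mul]
    rw [mul_add, inner_add_right, h1]
    have h3 : 2 * (‖v.1 t‖ * ‖f.1 t‖) ≤ η * ‖v.1 t‖ ^ 2 + ‖f.1 t‖ ^ 2 / η := by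
      have : η * ‖v.1 t‖ ^ 2 + ‖f.1 t‖ ^ 2 / η - 2 * (‖v.1 t‖ * ‖f.1 t‖) =
          (η * ‖v.1 t‖ - ‖f.1 t‖) ^ 2 / η := by
        field_simp
        ring
      have h4 : 0 ≤ (η * ‖v.1 t‖ - ‖f.1 t‖) ^ 2 / η := by positivity
      linarith
    have h5 : η * ‖v.1 t‖ ^ 2 ≤ z.im * ‖v.1 t‖ ^ 2 := by gcongr
    linarith
  -- On [0, T] the term |v(T)|² has a favourable sign and is dropped, so neither decay nor
  -- integrability of v is presupposed.
  refine eLpNorm_le_of_integral_sq_le hv (by positivity) fun T hT => ?_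
  have hdc : Continuous fun t => 2 * inner ℝ (v.1 t) (Complex.I * (z * v.1 t + f.1 t)) := by
    fun_prop
  have hint1 : IntervalIntegrable (fun t => -η * ‖v.1 t‖ ^ 2) volume 0 T :=
    (by fun_prop : Continuous fun t => -η * ‖v.1 t‖ ^ 2).intervalIntegrable _ _
  have hint2 : IntervalIntegrable (fun t => ‖f.1 t‖ ^ 2 / η) volume 0 T :=
    (by fun_prop : Continuous fun t => ‖f.1 t‖ ^ 2 / η).intervalIntegrable _ _
  have hftc := intervalIntegral.integral_eq_sub_of_hasDerivAt (a := 0) (b := T)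
    (fun t _ => hder t) (hdc.intervalIntegrable _ _)
  have hmono := intervalIntegral.integral_mono hT (hdc.intervalIntegrable _ _)
    (hint1.add hint2) hle
  rw [hftc] at hmono
  have hsplit : ∫ t in (0 : ℝ)..T, (-η * ‖v.1 t‖ ^ 2 + ‖f.1 t‖ ^ 2 / η) =
      -η * (∫ t in (0 : ℝ)..T, ‖v.1 t‖ ^ 2) + (∫ t in (0 : ℝ)..T, ‖f.1 t‖ ^ 2) / η := by
    rw [intervalIntegral.integral_add hint1 hint2, intervalIntegral.integral_const_mul,
      intervalIntegral.integral_div]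
  have hmono' : ‖v.1 T‖ ^ 2 - ‖v.1 0‖ ^ 2 ≤
      -η * (∫ t in (0 : ℝ)..T, ‖v.1 t‖ ^ 2) + (∫ t in (0 : ℝ)..T, ‖f.1 t‖ ^ 2) / η :=
    hmono.trans_eq hsplit
  have hfM := integral_sq_le_of_eLpNorm_le hfc hM hf hT
  have hfM' : (∫ t in (0 : ℝ)..T, ‖f.1 t‖ ^ 2) / η ≤ M ^ 2 / η := by gcongr
  have hT2 : 0 ≤ ‖v.1 T‖ ^ 2 := by positivity
  have hfin : ∫ t in (0 : ℝ)..T, ‖v.1 t‖ ^ 2 ≤ (‖v.1 0‖ ^ 2 + M ^ 2 / η) / η := by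
    rw [le_div_iff₀ hη]
    linarith
  refine hfin.trans ?_
  have hsq : (‖v.1 0‖ / √η) ^ 2 = ‖v.1 0‖ ^ 2 / η := by rw [div_pow, Real.sq_sqrt hη.le]
  have e : (‖v.1 0‖ ^ 2 + M ^ 2 / η) / η = (‖v.1 0‖ / √η) ^ 2 + (M / η) ^ 2 := by
    rw [hsq]
    field_simp
  rw [e]
  have : 0 ≤ ‖v.1 0‖ / √η * (M / η) := by positivity
  nlinarith

/-- A function which is square integrable together with its derivative tends to zero. -/
theorem tendsto_zero_of_eLpNorm_lt_top {v : smoothFun ⊤}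
    (hv : eLpNorm v.1 2 (volume.restrict (Ioi 0)) < ⊤)
    (hDv : eLpNorm (diffOp ⊤ v).1 2 (volume.restrict (Ioi 0)) < ⊤) :
    Tendsto v.1 atTop (𝓝 0) := by
  have h1 : MemLp v.1 2 (volume.restrict (Ioi (0 : ℝ))) :=
    ⟨(continuous v).aestronglyMeasurable, hv⟩
  have h2 : MemLp (diffOp ⊤ v).1 2 (volume.restrict (Ioi (0 : ℝ))) :=
    ⟨(continuous _).aestronglyMeasurable, hDv⟩
  have h3 := tendsto_zero_of_hasDerivAt_of_integrableOn_Ioi (a := 0)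
    (fun t _ => hasDerivAt_norm_sq v t) ?_
    ((memLp_two_iff_integrable_sq_norm (continuous v).aestronglyMeasurable).1 h1)
  · rw [tendsto_zero_iff_norm_tendsto_zero]
    have h4 := h3.sqrt
    simpa using h4
  · have h5 : Integrable (fun t => ‖v.1 t‖ * ‖(diffOp ⊤ v).1 t‖)
        (volume.restrict (Ioi (0 : ℝ))) := h1.norm.integrable_mul h2.norm
    have hc : Continuous fun t => 2 * inner ℝ (v.1 t) (Complex.I * (diffOp ⊤ v).1 t) := by
      have := continuous v
      have := continuous (diffOp ⊤ v)
      fun_prop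
    refine (h5.const_mul 2).mono' hc.aestronglyMeasurable (Eventually.of_forall fun t => ?_)
    rw [norm_mul, Real.norm_ofNat]
    refine mul_le_mul_of_nonneg_left ((norm_inner_le_norm _ _).trans ?_) (by norm_num)
    rw [norm_mul, Complex.norm_I, one_mul]

end smoothFun

end Energy

/-! ### Bounds in L² along the chain -/

namespace smoothFun

/-- The `L²` norm on the half-line is at most `M`. -/
def HasL2Bound (u : smoothFun ⊤) (M : ℝ) : Prop :=
  eLpNorm u.1 2 (volume.restrict (Ioi 0)) ≤ ENNReal.ofReal M

theorem HasL2Bound.mono {u : smoothFun ⊤} {M M' : ℝ} (h : HasL2Bound u M) (hM : M ≤ M') :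
    HasL2Bound u M' :=
  le_trans h (ENNReal.ofReal_le_ofReal hM)

theorem HasL2Bound.zero (M : ℝ) : HasL2Bound 0 M := by
  change eLpNorm (0 : ℝ → ℂ) 2 _ ≤ _
  simp

theorem HasL2Bound.add {u v : smoothFun ⊤} {M M' : ℝ} (hu : HasL2Bound u M)
    (hv : HasL2Bound v M') (hM : 0 ≤ M) (hM' : 0 ≤ M') : HasL2Bound (u + v) (M + M') := by
  refine (eLpNorm_add_le (continuous u).aestronglyMeasurable
    (continuous v).aestronglyMeasurable (by norm_num)).trans ?_
  rw [ENNReal.ofReal_add hM hM']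
  exact add_le_add hu hv

theorem HasL2Bound.smul {u : smoothFun ⊤} {M : ℝ} (hu : HasL2Bound u M) {c : ℂ} {r : ℝ}
    (hc : ‖c‖ ≤ r) : HasL2Bound (c • u) (r * M) := by
  have h : eLpNorm (c • u.1) 2 (volume.restrict (Ioi 0)) =
      ‖c‖ₑ * eLpNorm u.1 2 (volume.restrict (Ioi 0)) := eLpNorm_const_smul _ _ _ _
  change eLpNorm (c • u.1) 2 (volume.restrict (Ioi 0)) ≤ _
  rw [h, ENNReal.ofReal_mul ((norm_nonneg _).trans hc)]
  refine mul_le_mul' ?_ hu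
  rw [← ofReal_norm]
  exact ENNReal.ofReal_le_ofReal hc

theorem diffOp_pow_succ_chain (τ : ℕ → ℂ) (w : smoothFun ⊤) (l i : ℕ) :
    (diffOp ⊤ ^ (l + 1)) (chain τ w i) =
      (diffOp ⊤ ^ l) (chain τ w (i + 1)) + τ i • (diffOp ⊤ ^ l) (chain τ w i) := by
  rw [pow_succ, Module.End.mul_apply, diffOp_chain, map_add, map_smul]

/-- The weights of the estimate: `G b ^ (n - μ - 1/2)` for `n > μ`, `H a ^ n` for `n ≤ μ`. -/
def weight (μ : ℕ) (a b G H : ℝ) (n : ℕ) : ℝ :=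
  if n ≤ μ then H * a ^ n else G * b ^ (n - μ) / √b

/-- The data of a solution `w` of `∏ (D - τ i) w = 0`, whose first `μ` roots are of order `a` and
whose remaining roots are of order `b`. -/
structure ChainData (m μ : ℕ) (N a b G H : ℝ) (τ : ℕ → ℂ) (w : smoothFun ⊤) : Prop where
  le : μ ≤ m
  one_le : 1 ≤ N
  a_pos : 0 < a
  a_le : a ≤ b
  G_pos : 0 < G
  H_pos : 0 < H
  -- The two formulas for the weight must fit together at n = μ: the large one is no bigger there,
  -- and the step from μ to μ + 1 gains at least a factor a.
  G_le : G / √b ≤ H * a ^ μ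
  H_le : a * (H * a ^ μ) ≤ G * b / √b
  small : ∀ i < μ, ‖τ i‖ ≤ N * a ∧ a ≤ N * (τ i).im
  large : ∀ i < m, μ ≤ i → ‖τ i‖ ≤ N * b ∧ b ≤ N * (τ i).im
  last : chain τ w m = 0
  initial_small : ∀ i < μ, ‖(chain τ w i).1 0‖ ≤ N * (H * a ^ i * √a)
  initial_large : ∀ i < m, μ ≤ i → ‖(chain τ w i).1 0‖ ≤ N * (G * b ^ (i - μ))

namespace ChainData

variable {m μ : ℕ} {N a b G H : ℝ} {τ : ℕ → ℂ} {w : smoothFun ⊤}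

theorem b_pos (h : ChainData m μ N a b G H τ w) : 0 < b := h.a_pos.trans_le h.a_le

/-- The energy estimate with η = x/N. The boundary term is at most N²X and the source contributes
QNX, whence the factor 2N² per step. -/
theorem energy_step {x X Y Q : ℝ} {i : ℕ} (hN : 1 ≤ N) (hx : 0 < x) (hX : 0 ≤ X) (hQ : 1 ≤ Q)
    (him : x ≤ N * (τ i).im) (h0 : ‖(chain τ w i).1 0‖ ≤ N * (X * √x)) (hY : Y = X * x)
    (hnext : HasL2Bound (chain τ w (i + 1)) (Q * Y)) :
    HasL2Bound (chain τ w i) (Q * (2 * N ^ 2) * X) := by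
  have hN0 : 0 < N := one_pos.trans_le hN
  have hη : 0 < x / N := by positivity
  have hsx : 0 < √x := Real.sqrt_pos.2 hx
  have hsN : √N ≤ N := Real.sqrt_le_left (by positivity) |>.2 (by nlinarith)
  have key := eLpNorm_le_of_diffOp_sub_smul_eq (chain_succ τ w i).symm hη
    ((div_le_iff₀ hN0).2 (by linarith)) (by rw [hY]; positivity : 0 ≤ Q * Y) hnext
  refine HasL2Bound.mono key ?_
  have h1 : ‖(chain τ w i).1 0‖ / √(x / N) ≤ N ^ 2 * X := by
    rw [Real.sqrt_div hx.le, div_div_eq_mul_div, div_le_iff₀ hsx]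
    calc ‖(chain τ w i).1 0‖ * √N ≤ N * (X * √x) * N := by gcongr
      _ = N ^ 2 * X * √x := by ring
  have h2 : Q * Y / (x / N) = Q * N * X := by
    rw [hY]
    field_simp
  rw [h2]
  have h3 : N ^ 2 * X ≤ Q * (N ^ 2 * X) := le_mul_of_one_le_left (by positivity) hQ
  have h4 : Q * N * X ≤ Q * N ^ 2 * X := by
    gcongr
    nlinarith
  linarith

/-- Descending induction from the end of the chain, where the function is zero; each step divides by
b. -/
theorem bound_large (h : ChainData m μ N a b G H τ w) (k i : ℕ) (hki : i + k = m) (hi : μ ≤ i) :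
    HasL2Bound (chain τ w i) ((2 * N ^ 2) ^ k * (G * b ^ (i - μ) / √b)) := by
  have hb := h.b_pos
  have hG := h.G_pos
  induction k generalizing i with
  | zero =>
    obtain rfl : i = m := by omega
    rw [h.last]
    exact HasL2Bound.zero _
  | succ k ih =>
    have hsb : 0 < √b := Real.sqrt_pos.2 hb
    rw [pow_succ]
    refine energy_step h.one_le hb (by positivity)
      (one_le_pow₀ (by nlinarith [h.one_le])) (h.large i (by omega) hi).2 ?_ ?_
      (ih (i + 1) (by omega) (by omega))
    · refine (h.initial_large i (by omega) hi).trans_eq ?_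
      rw [div_mul_cancel₀ _ hsb.ne']
    · rw [Nat.succ_sub hi, pow_succ]
      ring

theorem bound_small (h : ChainData m μ N a b G H τ w) (k i : ℕ) (hki : i + k = m) (hi : i ≤ μ) :
    HasL2Bound (chain τ w i) ((2 * N ^ 2) ^ k * (H * a ^ i)) := by
  have ha := h.a_pos
  have hH := h.H_pos
  have hN := h.one_le
  induction k generalizing i with
  | zero =>
    have := h.le
    obtain rfl : i = m := by omega
    rw [h.last]
    exact HasL2Bound.zero _
  | succ k ih =>
    rcases hi.eq_or_lt with rfl | hlt
    -- At i = μ the descent passes from roots of order b to roots of order a, and `G_le` converts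
    -- the bound.
    · refine (h.bound_large _ i hki le_rfl).mono ?_
      rw [Nat.sub_self, pow_zero, mul_one]
      exact mul_le_mul_of_nonneg_left h.G_le (by positivity)
    · rw [pow_succ]
      refine energy_step hN ha (by positivity) (one_le_pow₀ (by nlinarith)) (h.small i hlt).2
        (h.initial_small i hlt) ?_ (ih (i + 1) (by omega) (by omega))
      rw [pow_succ]
      ring

theorem bound_diffOp_large (h : ChainData m μ N a b G H τ w) (l i : ℕ) (him : i ≤ m)
    (hi : μ ≤ i) : HasL2Bound ((diffOp ⊤ ^ l) (chain τ w i))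
      ((2 * N) ^ l * (2 * N ^ 2) ^ m * (G * b ^ (i + l - μ) / √b)) := by
  have hb := h.b_pos
  have hG := h.G_pos
  have hN := h.one_le
  have hN0 : 0 < N := one_pos.trans_le hN
  induction l generalizing i with
  | zero =>
    refine (h.bound_large (m - i) i (by omega) hi).mono ?_
    rw [pow_zero, one_mul, add_zero]
    gcongr
    · nlinarith
    · omega
  | succ l ih =>
    rcases him.eq_or_lt with rfl | hlt
    · rw [h.last, map_zero]
      exact HasL2Bound.zero _
    rw [diffOp_pow_succ_chain]
    refine ((ih (i + 1) hlt (by omega)).add ((ih i him hi).smul (h.large i hlt hi).1)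
      (by positivity) (by positivity)).mono ?_
    have e1 : i + 1 + l - μ = (i + l - μ) + 1 := by omega
    have e2 : i + (l + 1) - μ = (i + l - μ) + 1 := by omega
    rw [e1, e2, pow_succ b, pow_succ (2 * N)]
    set Z := (2 * N) ^ l * (2 * N ^ 2) ^ m * (G * b ^ (i + l - μ) / √b) with hZ
    have hZ0 : 0 ≤ Z := by positivity
    calc (2 * N) ^ l * (2 * N ^ 2) ^ m * (G * (b ^ (i + l - μ) * b) / √b) + N * b * Z
        = b * Z + N * (b * Z) := by rw [hZ]; ring
      _ ≤ N * (b * Z) + N * (b * Z) := by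
          have := le_mul_of_one_le_left (show 0 ≤ b * Z by positivity) hN
          linarith
      _ = _ := by rw [hZ]; ring

theorem weight_nonneg (h : ChainData m μ N a b G H τ w) (n : ℕ) : 0 ≤ weight μ a b G H n := by
  have ha := h.a_pos
  have hb := h.b_pos
  have hG := h.G_pos
  have hH := h.H_pos
  unfold weight
  split_ifs <;> positivity

theorem mul_weight_le (h : ChainData m μ N a b G H τ w) (n : ℕ) :
    a * weight μ a b G H n ≤ weight μ a b G H (n + 1) := by
  have ha := h.a_pos
  have hb := h.b_pos
  have hG := h.G_pos
  unfold weight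
  rcases lt_trichotomy n μ with hn | rfl | hn
  · rw [if_pos hn.le, if_pos (show n + 1 ≤ μ by omega), pow_succ]
    exact le_of_eq (by ring)
  · rw [if_pos le_rfl, if_neg (by omega)]
    simpa using h.H_le
  · rw [if_neg (by omega), if_neg (by omega), Nat.succ_sub hn.le, pow_succ]
    calc a * (G * b ^ (n - μ) / √b) ≤ b * (G * b ^ (n - μ) / √b) := by
          gcongr
          exact h.a_le
      _ = _ := by ring

theorem le_weight (h : ChainData m μ N a b G H τ w) {n : ℕ} (hn : μ ≤ n) :
    G * b ^ (n - μ) / √b ≤ weight μ a b G H n := by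
  unfold weight
  rcases hn.eq_or_lt with rfl | hlt
  · simpa using h.G_le
  · rw [if_neg (by omega)]

theorem bound_diffOp_small (h : ChainData m μ N a b G H τ w) (l i : ℕ) (hi : i ≤ μ) :
    HasL2Bound ((diffOp ⊤ ^ l) (chain τ w i))
      ((2 * N) ^ l * (2 * N ^ 2) ^ m * weight μ a b G H (i + l)) := by
  have hN := h.one_le
  have hN0 : 0 < N := one_pos.trans_le hN
  have ha := h.a_pos
  have hH := h.H_pos
  have hle := h.le
  have hw := h.weight_nonneg
  induction l generalizing i with
  | zero =>
    refine (h.bound_small (m - i) i (by omega) hi).mono ?_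
    rw [pow_zero, one_mul, add_zero, weight, if_pos hi]
    gcongr
    · nlinarith
    · omega
  | succ l ih =>
    rcases hi.eq_or_lt with rfl | hlt
    -- Once the small roots are used up, further derivatives are controlled at the scale b.
    · refine (h.bound_diffOp_large (l + 1) i hle le_rfl).mono ?_
      gcongr
      exact h.le_weight (by omega)
    rw [diffOp_pow_succ_chain]
    refine ((ih (i + 1) (by omega)).add ((ih i hi).smul (h.small i hlt).1)
      (mul_nonneg (by positivity) (hw _))
      (mul_nonneg (by positivity) (mul_nonneg (by positivity) (hw _)))).mono ?_
    have e1 : i + 1 + l = i + l + 1 := by omega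
    rw [e1, ← add_assoc, pow_succ]
    have h1 := h.mul_weight_le (i + l)
    set W := weight μ a b G H (i + l)
    set W' := weight μ a b G H (i + l + 1)
    set Q := (2 * N) ^ l * (2 * N ^ 2) ^ m with hQ
    have hQ0 : 0 ≤ Q := by positivity
    have hW' : 0 ≤ W' := hw _
    calc Q * W' + N * a * (Q * W) = Q * W' + N * Q * (a * W) := by ring
      _ ≤ Q * W' + N * Q * W' := by gcongr
      _ ≤ N * (Q * W') + N * Q * W' := by
          have := le_mul_of_one_le_left (show 0 ≤ Q * W' by positivity) hN
          linarith
      _ = _ := by rw [hQ]; ring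

end ChainData

end smoothFun

open smoothFun

/-! ### Initial data of the chain and choice of the weights -/

section Coefficients

variable {m μ : ℕ} {K a b : ℝ} {τ : ℕ → ℂ}

theorem prod_add_norm_le {x y : ℝ} (hx : 0 ≤ x) {s : Finset ℕ}
    (h : ∀ i ∈ s, x + ‖τ i‖ ≤ y) : ∏ i ∈ s, (x + ‖τ i‖) ≤ y ^ s.card := by
  rw [← Finset.prod_const]
  exact Finset.prod_le_prod (fun i _ => by positivity) h

theorem norm_coeff_le_of_small (hK : 1 ≤ K) (ha : 0 < a)
    (hsmall : ∀ i < μ, ‖τ i‖ ≤ K * a) {i : ℕ} (hi : i ≤ μ) (hμm : μ ≤ m) (k : ℕ) :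
    ‖(∏ s ∈ Finset.range i, (Polynomial.X - Polynomial.C (τ s))).coeff k‖ ≤
      (1 + K) ^ m * (a ^ i / a ^ k) := by
  rw [← mul_div_assoc, le_div_iff₀ (by positivity)]
  refine (norm_coeff_prod_X_sub_C_mul_pow_le τ ha.le i k).trans ?_
  refine (prod_add_norm_le (y := (1 + K) * a) ha.le fun s hs => ?_).trans ?_
  · have := hsmall s (by have := Finset.mem_range.1 hs; omega)
    linarith
  · rw [Finset.card_range, mul_pow]
    gcongr
    · linarith
    · omega

theorem norm_coeff_le_of_large (hK : 1 ≤ K) (ha : 0 < a) (hab : a ≤ b)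
    (hsmall : ∀ i < μ, ‖τ i‖ ≤ K * a) (hlarge : ∀ i < m, μ ≤ i → ‖τ i‖ ≤ K * b) {i : ℕ}
    (him : i < m) (k : ℕ) :
    ‖(∏ s ∈ Finset.range i, (Polynomial.X - Polynomial.C (τ s))).coeff k‖ ≤
      (1 + K) ^ m * (b ^ i / b ^ k) := by
  have hb : 0 < b := ha.trans_le hab
  rw [← mul_div_assoc, le_div_iff₀ (by positivity)]
  refine (norm_coeff_prod_X_sub_C_mul_pow_le τ hb.le i k).trans ?_
  refine (prod_add_norm_le (y := (1 + K) * b) hb.le fun s hs => ?_).trans ?_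
  · have hs := Finset.mem_range.1 hs
    have : ‖τ s‖ ≤ K * b := by
      rcases lt_or_ge s μ with h | h
      · exact (hsmall s h).trans (by gcongr)
      · exact hlarge s (by omega) h
    linarith
  · rw [Finset.card_range, mul_pow]
    gcongr
    linarith

/-- Evaluated at the scale a, the first μ factors have size a and the others size b. This serves j ≤
μ, where the scale b used in `norm_coeff_le_of_large` would be too coarse. -/
theorem norm_coeff_le_of_mixed (hK : 1 ≤ K) (ha : 0 < a) (hab : a ≤ b)
    (hsmall : ∀ i < μ, ‖τ i‖ ≤ K * a) (hlarge : ∀ i < m, μ ≤ i → ‖τ i‖ ≤ K * b) {i : ℕ}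
    (him : i < m) (hi : μ ≤ i) (k : ℕ) :
    ‖(∏ s ∈ Finset.range i, (Polynomial.X - Polynomial.C (τ s))).coeff k‖ ≤
      (1 + K) ^ m * (a ^ μ / a ^ k * b ^ (i - μ)) := by
  have hb : 0 < b := ha.trans_le hab
  rw [div_mul_eq_mul_div, ← mul_div_assoc, le_div_iff₀ (by positivity)]
  refine (norm_coeff_prod_X_sub_C_mul_pow_le τ ha.le i k).trans ?_
  rw [← Finset.prod_range_mul_prod_Ico _ hi]
  have h1 : ∏ s ∈ Finset.range μ, (a + ‖τ s‖) ≤ ((1 + K) * a) ^ μ := by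
    have := prod_add_norm_le (τ := τ) (y := (1 + K) * a) ha.le (s := Finset.range μ) fun s hs => by
      have := hsmall s (Finset.mem_range.1 hs)
      linarith
    rwa [Finset.card_range] at this
  have h2 : ∏ s ∈ Finset.Ico μ i, (a + ‖τ s‖) ≤ ((1 + K) * b) ^ (i - μ) := by
    have := prod_add_norm_le (τ := τ) (y := (1 + K) * b) ha.le (s := Finset.Ico μ i) fun s hs => by
      obtain ⟨hs1, hs2⟩ := Finset.mem_Ico.1 hs
      have := hlarge s (by omega) hs1
      linarith
    rwa [Nat.card_Ico] at this
  calc _ ≤ ((1 + K) * a) ^ μ * ((1 + K) * b) ^ (i - μ) :=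
        mul_le_mul h1 h2 (Finset.prod_nonneg fun _ _ => by positivity) (by positivity)
    _ = (1 + K) ^ (μ + (i - μ)) * (a ^ μ * b ^ (i - μ)) := by
        rw [mul_pow, mul_pow, pow_add]
        ring
    _ ≤ (1 + K) ^ m * (a ^ μ * b ^ (i - μ)) := by
        gcongr
        · linarith
        · omega

end Coefficients

/-- The canonical solutions of the problem on the half-line, with the data which enter the
estimate. -/
theorem exists_chainData {m μ : ℕ} {K a b : ℝ} {τ : ℕ → ℂ} (hμm : μ < m) (hK : 1 ≤ K) (ha : 0 < a)
    (hab : a ≤ b) (hsmall : ∀ i < μ, ‖τ i‖ ≤ K * a ∧ a ≤ K * (τ i).im)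
    (hlarge : ∀ i < m, μ ≤ i → ‖τ i‖ ≤ K * b ∧ b ≤ K * (τ i).im) {j : ℕ} (hj : 1 ≤ j) :
    ∃ (w : smoothFun ⊤) (G H : ℝ), ChainData m μ ((1 + K) ^ m) a b G H τ w ∧
      (∀ l < m, ((diffOp ⊤ ^ l) w).1 0 = if j = l + 1 then 1 else 0) ∧
      ∀ l, weight μ a b G H l = estimateBound μ j l a b := by
  obtain ⟨k, rfl⟩ : ∃ k, j = k + 1 := ⟨j - 1, by omega⟩
  have hb : 0 < b := ha.trans_le hab
  have hsa : 0 < √a := Real.sqrt_pos.2 ha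
  have hsb : 0 < √b := Real.sqrt_pos.2 hb
  have hsa2 : √a * √a = a := Real.mul_self_sqrt ha.le
  have hsb2 : √b * √b = b := Real.mul_self_sqrt hb.le
  have hsab : √a ≤ √b := Real.sqrt_le_sqrt hab
  have hKN : K ≤ (1 + K) ^ m := by
    calc K ≤ (1 + K) ^ 1 := by linarith
      _ ≤ (1 + K) ^ m := pow_le_pow_right₀ (by linarith) (by omega)
  -- With j = k + 1, these initial values make the functional P ↦ (P(D)w)(0) equal to the k-th
  -- coefficient on degrees below m.
  obtain ⟨w, hw, hw0⟩ := exists_chain m τ fun i =>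
    (∏ s ∈ Finset.range i, (Polynomial.X - Polynomial.C (τ s))).coeff k
  have hinit : ∀ l < m, ((diffOp ⊤ ^ l) w).1 0 = if k + 1 = l + 1 then 1 else 0 := by
    intro l hl
    have := diffOp_pow_chain_zero hw0 l 0 (by omega)
    rw [chain_zero, Finset.range_zero, Finset.prod_empty, mul_one, Polynomial.coeff_X_pow] at this
    rw [this]
    simp
  have himpos : ∀ i : ℕ, 0 < K * (τ i).im → 0 ≤ (τ i).im := fun i h =>
    ((mul_pos_iff_of_pos_left (by linarith)).1 h).le
  have hsmall' : ∀ i < μ, ‖τ i‖ ≤ (1 + K) ^ m * a ∧ a ≤ (1 + K) ^ m * (τ i).im := by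
    intro i hi
    obtain ⟨h1, h2⟩ := hsmall i hi
    have := himpos i (ha.trans_le h2)
    exact ⟨h1.trans (by gcongr), h2.trans (by gcongr)⟩
  have hlarge' : ∀ i < m, μ ≤ i → ‖τ i‖ ≤ (1 + K) ^ m * b ∧ b ≤ (1 + K) ^ m * (τ i).im := by
    intro i hi hi'
    obtain ⟨h1, h2⟩ := hlarge i hi hi'
    have := himpos i (hb.trans_le h2)
    exact ⟨h1.trans (by gcongr), h2.trans (by gcongr)⟩
  have hrpow : ∀ {x : ℝ}, 0 < x → ∀ n : ℕ, x ^ n = x ^ (n : ℝ) := fun _ n =>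
    (Real.rpow_natCast _ n).symm
  by_cases hkμ : k + 1 ≤ μ
  -- For j ≤ μ: G = a^{1+μ-j} and H = a^{1/2-j}, read off from the first two lines of the estimate.
  · refine ⟨w, a ^ μ / a ^ k, √a / a ^ (k + 1), ⟨hμm.le, hK.trans hKN, ha, hab, by positivity,
      by positivity, ?_, ?_, hsmall', hlarge', hw, fun i hi => ?_, fun i hi hi' => ?_⟩, hinit,
      fun l => ?_⟩
    · rw [div_le_iff₀ hsb]
      calc a ^ μ / a ^ k = √a / a ^ (k + 1) * a ^ μ * √a := by
            rw [pow_succ]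
            field_simp
            rw [sq, hsa2]
        _ ≤ √a / a ^ (k + 1) * a ^ μ * √b := by gcongr
    · calc a * (√a / a ^ (k + 1) * a ^ μ) = a ^ μ / a ^ k * √a := by
            rw [pow_succ]
            field_simp
        _ ≤ a ^ μ / a ^ k * √b := by gcongr
        _ = a ^ μ / a ^ k * b / √b := by
            rw [mul_div_assoc, Real.div_sqrt]
    · rw [hw0 i (by omega)]
      refine (norm_coeff_le_of_small hK ha (fun i hi => (hsmall i hi).1) hi.le hμm.le k).trans_eq ?_
      rw [pow_succ]
      field_simp
      rw [sq, hsa2]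
    · rw [hw0 i hi]
      exact norm_coeff_le_of_mixed hK ha hab (fun i hi => (hsmall i hi).1)
        (fun i hi hi' => (hlarge i hi hi').1) hi hi' k
    · rw [weight, estimateBound, if_pos hkμ]
      split_ifs with hl
      · rw [Real.sqrt_eq_rpow, hrpow ha, hrpow ha, ← Real.rpow_sub ha, ← Real.rpow_add ha]
        congr 1
        push_cast
        ring
      · rw [Real.sqrt_eq_rpow, hrpow ha, hrpow ha, hrpow hb, ← Real.rpow_sub ha, mul_div_assoc,
          ← Real.rpow_sub hb, Nat.cast_sub (by omega)]
        congr 2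
        push_cast
        ring
  -- For j > μ: G = b^{1+μ-j} and H = a^{-μ}b^{μ-j+1/2}, read off from the last two lines.
  · refine ⟨w, b ^ μ / b ^ k, √b * b ^ μ / (a ^ μ * b ^ (k + 1)), ⟨hμm.le, hK.trans hKN, ha, hab,
      by positivity, by positivity, ?_, ?_, hsmall', hlarge', hw, fun i hi => ?_,
      fun i hi hi' => ?_⟩, hinit, fun l => ?_⟩
    · refine le_of_eq ?_
      rw [pow_succ]
      field_simp
      rw [sq, hsb2]
    · calc a * (√b * b ^ μ / (a ^ μ * b ^ (k + 1)) * a ^ μ)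
          ≤ b * (√b * b ^ μ / (a ^ μ * b ^ (k + 1)) * a ^ μ) := by gcongr
        _ = b ^ μ / b ^ k * √b := by
            rw [pow_succ]
            field_simp
        _ = b ^ μ / b ^ k * b / √b := by
            rw [mul_div_assoc, Real.div_sqrt]
    -- Since i < μ ≤ k, the product of degree i has no k-th coefficient: the small part of the chain
    -- starts from zero.
    · rw [hw0 i (by omega), Polynomial.coeff_eq_zero_of_natDegree_lt, norm_zero]
      · positivity
      · rw [Polynomial.natDegree_prod_of_monic _ _ fun s _ => Polynomial.monic_X_sub_C _]
        simp only [Polynomial.natDegree_X_sub_C, Finset.sum_const, Finset.card_range, smul_eq_mul]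
        omega
    · rw [hw0 i hi]
      refine (norm_coeff_le_of_large hK ha hab (fun i hi => (hsmall i hi).1)
        (fun i hi hi' => (hlarge i hi hi').1) hi k).trans_eq ?_
      rw [div_mul_eq_mul_div, ← pow_add, Nat.add_sub_cancel' hi']
    · rw [weight, estimateBound, if_neg hkμ]
      split_ifs with hl
      · rw [Real.sqrt_eq_rpow, Real.rpow_sub ha, Real.rpow_add hb, Real.rpow_sub hb,
          ← hrpow ha, ← hrpow ha, ← hrpow hb, ← hrpow hb]
        ring
      · rw [Real.sqrt_eq_rpow, hrpow hb, hrpow hb, hrpow hb, ← Real.rpow_sub hb,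
          ← Real.rpow_add hb, ← Real.rpow_sub hb, Nat.cast_sub (by omega)]
        congr 1
        push_cast
        ring

/-! ### Regularity, uniqueness and existence for the half-line problem -/

theorem iteratedDerivWithin_Ici_eq (l : ℕ) (w : ℝ → ℂ) {t : ℝ} (ht : 0 < t) :
    iteratedDerivWithin l w (Ici 0) t = iteratedDeriv l w t := by
  rw [iteratedDerivWithin, iteratedDeriv, ← iteratedFDerivWithin_univ,
    iteratedFDerivWithin_congr_set (eventuallyEq_univ.2 (Ici_mem_nhds ht))]

theorem Dt_of_pos (l : ℕ) (w : ℝ → ℂ) {t : ℝ} (ht : 0 < t) :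
    Dt l w t = (-Complex.I) ^ l * iteratedDeriv l w t := by
  rw [Dt, iteratedDerivWithin_Ici_eq l w ht]

theorem Dt_smoothFun (l : ℕ) (w : smoothFun ⊤) {t : ℝ} (ht : 0 ≤ t) :
    Dt l w.1 t = ((diffOp ⊤ ^ l) w).1 t := by
  rw [diffOp_pow_apply w l (Set.mem_univ t), Dt, iteratedDerivWithin_eq_iteratedDeriv
    (uniqueDiffOn_Ici 0) ((contDiff w).of_le (by exact_mod_cast le_top)).contDiffAt ht]

theorem Dt_restrict {v : ℝ → ℂ} (hv : ContDiffOn ℝ ∞ v halfLine) (l : ℕ) {t : ℝ} (ht : 0 < t) :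
    ((diffOp halfLine ^ l) (restrict halfLine v hv)).1 t = Dt l v t := by
  rw [diffOp_pow_apply _ l (mem_halfLine.2 ht), Dt_of_pos l v ht]
  congr 1
  exact ((restrict_eventuallyEq hv (mem_halfLine.2 ht)).iteratedDeriv_eq l)

/-- A solution of a linear equation with constant coefficients, resolved with respect to the
derivative of highest order, is smooth. -/
theorem contDiffOn_infty_of_iteratedDeriv_eq {U : Set ℝ} (hU : IsOpen U) {N : ℕ} (hN : 0 < N)
    {v : ℝ → ℂ} (hv : ContDiffOn ℝ N v U) (c : ℕ → ℂ)
    (h : ∀ t ∈ U, iteratedDeriv N v t = ∑ k ∈ Finset.range N, c k * iteratedDeriv k v t) :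
    ContDiffOn ℝ ∞ v U := by
  -- All derivatives of order below N gain regularity together; the equation supplies the derivative
  -- of the last one.
  suffices hmain : ∀ n : ℕ, ∀ k < N, ContDiffOn ℝ n (iteratedDeriv k v) U by
    rw [contDiffOn_infty]
    intro n
    simpa using hmain n 0 hN
  intro n
  induction n with
  | zero =>
    intro k hk
    rw [Nat.cast_zero, contDiffOn_zero]
    exact (hv.continuousOn_iteratedDerivWithin (by exact_mod_cast hk.le) hU.uniqueDiffOn).congr
      fun t ht => (iteratedDerivWithin_of_isOpen hU ht).symm
  | succ n ih =>
    intro k hk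
    rw [Nat.cast_succ, contDiffOn_succ_iff_deriv_of_isOpen hU]
    refine ⟨(hv.differentiableOn_iteratedDerivWithin (by exact_mod_cast hk) hU.uniqueDiffOn).congr
      fun t ht => (iteratedDerivWithin_of_isOpen hU ht).symm, by simp, ?_⟩
    rw [← iteratedDeriv_succ]
    rcases (Nat.succ_le_of_lt hk).lt_or_eq with hlt | heq
    · exact ih (k + 1) hlt
    · have hsum : ContDiffOn ℝ n (fun t => ∑ k ∈ Finset.range N, c k * iteratedDeriv k v t) U :=
        ContDiffOn.sum fun k hk => contDiffOn_const.mul (ih k (Finset.mem_range.1 hk))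
      refine hsum.congr fun t ht => ?_
      rw [← Nat.succ_eq_add_one, heq, h t ht]

theorem iteratedDeriv_eq_of_sum_eq_zero {p : ℂ[X]} (hp : p ≠ 0) {v : ℝ → ℂ} {t : ℝ} (ht : 0 < t)
    (h : (p.sum fun k a => a * Dt k v t) = 0) :
    iteratedDeriv p.natDegree v t = ∑ k ∈ Finset.range p.natDegree,
      (-(p.coeff k * (-Complex.I) ^ k) / (p.leadingCoeff * (-Complex.I) ^ p.natDegree)) *
        iteratedDeriv k v t := by
  have hne : p.leadingCoeff * (-Complex.I) ^ p.natDegree ≠ 0 :=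
    mul_ne_zero (Polynomial.leadingCoeff_ne_zero.2 hp)
      (pow_ne_zero _ (neg_ne_zero.2 Complex.I_ne_zero))
  rw [Polynomial.sum_over_range _ (by simp), Finset.sum_range_succ] at h
  simp only [Dt_of_pos _ v ht, ← mul_assoc] at h
  rw [Polynomial.coeff_natDegree] at h
  simp only [div_mul_eq_mul_div, neg_mul]
  rw [← Finset.sum_div, eq_div_iff hne, Finset.sum_neg_distrib]
  linear_combination h

theorem prod_range_eq_prod_map {M : Type*} [CommMonoid M] (m : ℕ) (f : ℕ → M) :
    ∏ i ∈ Finset.range m, f i = ((List.range m).map f).prod := by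
  rw [Finset.prod_eq_multiset_prod, Finset.range_val, Multiset.range, Multiset.map_coe,
    Multiset.prod_coe]

section Solution

variable {d m μ : ℕ} {A : ℕ → MvPolynomial (Fin (d + 1)) ℂ} {ξ' : EuclideanSpace ℝ (Fin d)}
  {lam : ℝ} {j : ℕ} {K a b : ℝ} {τ : ℕ → ℂ}

theorem IsHalfLineSolution.contDiffOn_infty {v : ℝ → ℂ}
    (hdeg : (symbolPoly A m μ ξ' lam).natDegree = 2 * m) (hm : 0 < m)
    (hv : IsHalfLineSolution A m μ ξ' lam j v) : ContDiffOn ℝ ∞ v halfLine := by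
  have hp : symbolPoly A m μ ξ' lam ≠ 0 := fun h => by
    rw [h, Polynomial.natDegree_zero] at hdeg
    omega
  have h := fun (t : ℝ) (ht : t ∈ Ioi 0) =>
    iteratedDeriv_eq_of_sum_eq_zero hp ht (hv.equation t ht)
  exact contDiffOn_infty_of_iteratedDeriv_eq isOpen_Ioi (by omega)
    (by rw [hdeg]; exact hv.contDiffOn_Ioi) _ h

theorem IsHalfLineSolution.tendsto_Dt {v : ℝ → ℂ}
    (hv : IsHalfLineSolution A m μ ξ' lam j v) {k : ℕ} (hk : k < m) :
    Tendsto (Dt k v) (𝓝[>] 0) (𝓝 (Dt k v 0)) := by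
  have h := hv.contDiffOn_Ici.continuousOn_iteratedDerivWithin (m := k)
    (by exact_mod_cast (by omega : k ≤ m - 1)) (uniqueDiffOn_Ici 0)
  exact ((h 0 self_mem_Ici).mono_left (nhdsWithin_mono _ Ioi_subset_Ici_self)).const_mul _

/-- The difference of two solutions decays, so the factor with lower roots can be cancelled. What
remains has order m and m vanishing limits at 0+, available because solutions are m - 1 times
continuously differentiable up to 0. -/
theorem IsHalfLineSolution.eqOn {v₁ v₂ : ℝ → ℂ} (hm : 0 < m)
    (hdeg : (symbolPoly A m μ ξ' lam).natDegree = 2 * m)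
    (hsplit : SplitsWithOrders (symbolPoly A m μ ξ' lam) m μ K a b τ)
    (hτ : ∀ i < m, 0 < (τ i).im)
    (h₁ : IsHalfLineSolution A m μ ξ' lam j v₁) (h₂ : IsHalfLineSolution A m μ ξ' lam j v₂) :
    EqOn v₁ v₂ (Ici 0) := by
  have hs₁ := h₁.contDiffOn_infty hdeg hm
  have hs₂ := h₂.contDiffOn_infty hdeg hm
  set u₁ := restrict halfLine v₁ hs₁ with hu₁
  set u₂ := restrict halfLine v₂ hs₂ with hu₂
  obtain ⟨⟨c, s, hc, hs, hfac⟩, -⟩ := hsplit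
  have hann : ∀ v (hv : ContDiffOn ℝ ∞ v halfLine), IsHalfLineSolution A m μ ξ' lam j v →
      Polynomial.aeval (diffOp halfLine) (symbolPoly A m μ ξ' lam) (restrict halfLine v hv) =
        0 := by
    intro v hv hsol
    refine ext_on fun t ht => ?_
    rw [aeval_diffOp_apply]
    simp only [Dt_restrict hv _ ht]
    exact hsol.equation t ht
  have hzero : Polynomial.aeval (diffOp halfLine) (symbolPoly A m μ ξ' lam) (u₁ - u₂) = 0 := by
    rw [map_sub, hann v₁ hs₁ h₁, hann v₂ hs₂ h₂, sub_zero]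
  have hvan : Vanishing (u₁ - u₂) := by
    intro t ht
    have htend : Tendsto (fun k : ℕ => t + k) atTop atTop :=
      tendsto_atTop_add_const_left _ _ tendsto_natCast_atTop_atTop
    have := (h₁.decay.comp htend).sub (h₂.decay.comp htend)
    rw [sub_zero] at this
    refine this.congr fun k => ?_
    have hpos : 0 < t + (k : ℝ) := by positivity
    change _ = u₁.1 (t + k) - u₂.1 (t + k)
    rw [hu₁, hu₂, restrict_apply hs₁ hpos, restrict_apply hs₂ hpos]
    rfl
  have hprod : diffProd halfLine s (diffProd halfLine ((List.range m).map τ) (u₁ - u₂)) = 0 := by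
    rw [hfac, mul_assoc, prod_range_eq_prod_map, mul_comm (List.prod _), map_mul,
      Polynomial.aeval_C, Module.End.mul_apply, map_mul, Module.End.mul_apply,
      aeval_prod_X_sub_C] at hzero
    have hcomp : ((List.range m).map fun i => (Polynomial.X - Polynomial.C (τ i) : ℂ[X])) =
        ((List.range m).map τ).map fun z => Polynomial.X - Polynomial.C z := by
      rw [List.map_map]
      rfl
    rw [hcomp, aeval_prod_X_sub_C] at hzero
    exact (smul_eq_zero.1 hzero).resolve_left hc
  have hτ' : ∀ z ∈ (List.range m).map τ, 0 < z.im := by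
    intro z hz
    obtain ⟨i, hi, rfl⟩ := List.mem_map.1 hz
    exact hτ i (List.mem_range.1 hi)
  have hu : u₁ - u₂ = 0 := by
    refine eq_zero_of_diffProd_eq_zero (diffProd_eq_zero_of_vanishing hτ' hs hprod hvan) ?_
    intro k hk
    rw [List.length_map, List.length_range] at hk
    have hinit : Dt k v₁ 0 = Dt k v₂ 0 := by
      have hk' : k + 1 ∈ Finset.Icc 1 m := Finset.mem_Icc.2 ⟨by omega, by omega⟩
      have e₁ := h₁.initial _ hk'
      have e₂ := h₂.initial _ hk'
      rw [Nat.add_sub_cancel] at e₁ e₂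
      rw [e₁, e₂]
    have := (h₁.tendsto_Dt hk).sub (h₂.tendsto_Dt hk)
    rw [hinit, sub_self] at this
    refine this.congr' ?_
    filter_upwards [self_mem_nhdsWithin] with t ht
    rw [map_sub]
    change _ = ((diffOp halfLine ^ k) u₁).1 t - ((diffOp halfLine ^ k) u₂).1 t
    rw [hu₁, hu₂, Dt_restrict hs₁ k ht, Dt_restrict hs₂ k ht]
  intro t ht
  rcases (show 0 ≤ t from ht).eq_or_lt with rfl | hpos
  · have hk' : 1 ∈ Finset.Icc 1 m := Finset.mem_Icc.2 ⟨le_rfl, hm⟩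
    have := (h₁.initial 1 hk').trans (h₂.initial 1 hk').symm
    simpa [Dt] using this
  · have := congrArg (fun f : smoothFun halfLine => f.1 t) (sub_eq_zero.1 hu)
    rw [hu₁, hu₂] at this
    simpa only [restrict_apply hs₁ hpos, restrict_apply hs₂ hpos] using this

/-- The equation holds because its upper factor already annihilates w. Decay follows from the bounds
in L² for w and Dw. -/
theorem isHalfLineSolution_of_chainData {N G H : ℝ} {w : smoothFun ⊤}
    (hsplit : SplitsWithOrders (symbolPoly A m μ ξ' lam) m μ K a b τ)
    (hw : ChainData m μ N a b G H τ w)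
    (hinit : ∀ l < m, ((diffOp ⊤ ^ l) w).1 0 = if j = l + 1 then 1 else 0) :
    IsHalfLineSolution A m μ ξ' lam j w.1 where
  contDiffOn_Ioi := (contDiff_infty.1 (contDiff w) _).contDiffOn
  contDiffOn_Ici := (contDiff_infty.1 (contDiff w) _).contDiffOn
  equation t ht := by
    obtain ⟨⟨c, s, hc, hs, hfac⟩, -⟩ := hsplit
    simp only [Dt_smoothFun _ w ht.le]
    rw [← aeval_diffOp_apply, hfac, mul_right_comm, map_mul, Module.End.mul_apply]
    have hlast := hw.last
    rw [chain] at hlast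
    rw [hlast, map_zero]
    rfl
  initial k hk := by
    obtain ⟨hk1, hk2⟩ := Finset.mem_Icc.1 hk
    rw [Dt_smoothFun _ w le_rfl, hinit (k - 1) (by omega), Nat.sub_add_cancel hk1]
  decay := by
    have h0 := hw.bound_diffOp_small 0 0 (Nat.zero_le _)
    have h1 := hw.bound_diffOp_small 1 0 (Nat.zero_le _)
    rw [chain_zero] at h0 h1
    exact tendsto_zero_of_eLpNorm_lt_top (h0.trans_lt ENNReal.ofReal_lt_top)
      (h1.trans_lt ENNReal.ofReal_lt_top)

end Solution

end OdePencil

end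

/-! ### Proof of the theorem -/

open OdePencil OdePencil.smoothFun in
theorem theorem4p1 (d m μ : ℕ) (hμm : μ < m)
    (A : ℕ → MvPolynomial (Fin (d + 1)) ℂ)
    (hhom : ∀ j ∈ Finset.Icc (2 * μ) (2 * m), (A j).IsHomogeneous j)
    (hell : OdePencil.IsNElliptic A m μ)
    (hdeg : OdePencil.DegeneratesRegularly A m μ)
    (hroots : d ≤ 1 → ∀ ξ' : EuclideanSpace ℝ (Fin d), ξ' ≠ 0 → ∀ lam : ℝ, 0 ≤ lam →
      OdePencil.numUpperRoots (OdePencil.symbolPoly A m μ ξ' lam) = m) :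
    (∀ j ∈ Finset.Icc 1 m, ∀ ξ' : EuclideanSpace ℝ (Fin d), ξ' ≠ 0 → ∀ lam : ℝ, 0 ≤ lam →
      ∃ w : ℝ → ℂ, OdePencil.IsHalfLineSolution A m μ ξ' lam j w ∧
        ContDiffOn ℝ ∞ w (Ici 0) ∧
        ∀ v : ℝ → ℂ, OdePencil.IsHalfLineSolution A m μ ξ' lam j v → EqOn v w (Ici 0)) ∧
    (∀ j ∈ Finset.Icc 1 m, ∀ l : ℕ, ∃ C : ℝ, 0 < C ∧
      ∀ ξ' : EuclideanSpace ℝ (Fin d), ξ' ≠ 0 → ∀ lam : ℝ, 0 ≤ lam →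
      ∀ w : ℝ → ℂ, OdePencil.IsHalfLineSolution A m μ ξ' lam j w →
        eLpNorm (OdePencil.Dt l w) 2 (volume.restrict (Ioi 0))
          ≤ ENNReal.ofReal (C * OdePencil.estimateBound μ j l ‖ξ'‖ (lam + ‖ξ'‖))) := by
  have hm : 0 < m := by omega
  obtain ⟨K, hK, hsplit⟩ := exists_splitsWithOrders hμm hhom hell hdeg hroots
  have hKN : 0 < (1 + K) ^ m := by positivity
  -- The constant depends only on K, m and l, so it is uniform in ξ' and λ.
  have hsol : ∀ j ∈ Finset.Icc 1 m, ∀ ξ' : EuclideanSpace ℝ (Fin d), ξ' ≠ 0 → ∀ lam : ℝ,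
      0 ≤ lam → ∃ w : smoothFun ⊤, IsHalfLineSolution A m μ ξ' lam j w.1 ∧
        (∀ v : ℝ → ℂ, IsHalfLineSolution A m μ ξ' lam j v → EqOn v w.1 (Ici 0)) ∧
        ∀ l, HasL2Bound ((diffOp ⊤ ^ l) w) ((2 * (1 + K) ^ m) ^ l *
          (2 * ((1 + K) ^ m) ^ 2) ^ m * estimateBound μ j l ‖ξ'‖ (lam + ‖ξ'‖)) := by
    intro j hj ξ' hξ lam hlam
    have ha : 0 < ‖ξ'‖ := norm_pos_iff.2 hξ
    obtain ⟨τ, hτ⟩ := hsplit ξ' hξ lam hlam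
    obtain ⟨w, G, H, hw, hinit, hweight⟩ := exists_chainData hμm hK ha
      (by linarith : ‖ξ'‖ ≤ lam + ‖ξ'‖) hτ.2.1 hτ.2.2 (Finset.mem_Icc.1 hj).1
    have hws := isHalfLineSolution_of_chainData hτ hw hinit
    have hτim : ∀ i < m, 0 < (τ i).im := by
      intro i hi
      have hKi : 0 < K * (τ i).im := by
        rcases lt_or_ge i μ with h | h
        · exact ha.trans_le (hτ.2.1 i h).2
        · exact lt_of_lt_of_le (by linarith) (hτ.2.2 i hi h).2
      exact (mul_pos_iff_of_pos_left (by linarith)).1 hKi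
    refine ⟨w, hws, fun v hv => hv.eqOn hm (natDegree_symbolPoly hμm hhom hell _ _) hτ hτim hws,
      fun l => ?_⟩
    have := hw.bound_diffOp_small l 0 (Nat.zero_le _)
    rwa [chain_zero, zero_add, hweight] at this
  refine ⟨fun j hj ξ' hξ lam hlam => ?_, fun j hj l => ?_⟩
  · obtain ⟨w, hw, huniq, -⟩ := hsol j hj ξ' hξ lam hlam
    exact ⟨w.1, hw, (contDiff w).contDiffOn, huniq⟩
  · refine ⟨(2 * (1 + K) ^ m) ^ l * (2 * ((1 + K) ^ m) ^ 2) ^ m, by positivity,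
      fun ξ' hξ lam hlam v hv => ?_⟩
    obtain ⟨w, hw, huniq, hbound⟩ := hsol j hj ξ' hξ lam hlam
    -- By uniqueness an arbitrary solution agrees on [0, ∞) with the constructed one, so their
    -- derivatives have the same norm.
    refine le_trans (le_of_eq ?_) (hbound l)
    refine eLpNorm_congr_ae ?_
    filter_upwards [ae_restrict_mem measurableSet_Ioi] with t ht
    rw [← Dt_smoothFun l w (le_of_lt ht), Dt, Dt,
      iteratedDerivWithin_congr (huniq v hv) (le_of_lt (show 0 < t from ht))]
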